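/- Let $n\ge 0$. Summation over repeated indices is understood. For an open set $U\subset\mathbb R^n$ let $S_2(U)$ be the space of 2-jets at $0$ of smooth maps $f$ into $U$ that are regular at $0\in\mathbb R^n$, with the coordinates $y^i=f^i(0)$, $y^i_j=\partial_jf^i(0)$, $y^i_{jk}=v^p_j\,\partial_p\partial_qf^i(0)\,v^q_k$, where $(v^i_j)=(y^i_j)^{-1}$. The group $O(n)$ acts by $(y^i,y^i_j,y^i_{jk})\mapsto(y^i,y^i_pA^p_j,y^i_{jk})$; the quotient $S_2(U)/O(n)$ has the coordinates $y^i$, $y^{ij}$ (a symmetric positive definite matrix) and $y^i_{jk}=y^i_{kj}$, and the projection is $p:(y^i,y^i_j,y^i_{jk})\mapsto(y^i,\sum_l y^i_ly^j_l,y^i_{jk})$. A regular map $h:U\to V$ of open subsets of $\mathbb R^n$ (a smooth map with invertible differentials), with components $\alpha^i(y)$, induces $\tilde h:S_2(U)/O(n)\to S_2(V)/O(n)$ by $\alpha^i=\alpha^i(y)$, $\alpha^{ij}=\frac{\partial\alpha^i}{\partial y^k}y^{kl}\frac{\partial\alpha^j}{\partial y^l}$, $\alpha^i_{jk}=\frac{\partial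 y^p}{\partial\alpha^j}\frac{\partial^2\alpha^i}{\partial y^p\partial y^q}\frac{\partial y^q}{\partial\alpha^k}+\frac{\partial y^p}{\partial\alpha^j}\frac{\partial\alpha^i}{\partial y^s}\frac{\partial y^q}{\partial\alpha^k}y^s_{pq}$. Put $(y_{ij})=(y^{ij})^{-1}$ and $$\Gamma_1=-v^i_k\,dy^k_i+y^i_{ik}\,dy^k\ \text{ on } S_2(U),\qquad \Lambda_1=-\tfrac12\,y_{ij}\,dy^{ij}+y^j_{jk}\,dy^k\ \text{ on } S_2(U)/O(n).$$ (1) $\Lambda_1$ is canonical: $\tilde h^*\Lambda_1=\Lambda_1$ for every regular map $h:U\to V$ of open subsets of $\mathbb R^n$. (2) $p^*\Lambda_1=\Gamma_1$, and $\Gamma_1=\theta^i_i$ is the trace of the first order part of the canonical Gelfand–Kazhdan form: if a tangent vector $\tau$ of $S_2(U)$ is represented by a smooth family $k_u$ of maps regular at $0$, then $\Gamma_1(\tau)=\sum_i\partial_i\theta^i(0)$, where $\theta$ is the germ at $0$ of the vector field $-\frac{d}{du}\big(k_0^{-1}\circ k_u\big)\big|_{u=0}$. (3) $d\Lambda_1=d\Gamma_1$,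 in the sense that $p^*d\Lambda_1=d\Gamma_1$ and both forms have the coordinate expression $dy^k_{kl}\wedge dy^l$. (4) Let $X=M/P$, where $P$ is a pseudogroup of smooth local diffeomorphisms of a smooth $n$-manifold $M$. A $k$-form on $S_2(X)/O(n)$ is a $P$-invariant smooth $k$-form on $S_2(M)/O(n)$, and $H^*(S_2(X)/O(n))$ is the cohomology of the complex of these forms. Then $\Lambda_1$ defines a 1-form on $S_2(X)/O(n)$, the form $\Lambda_1\wedge(d\Lambda_1)^n$ is a closed $(2n+1)$-form on $S_2(X)/O(n)$, and its class, the Godbillon–Vey–Losik class of $X$ with values in $H^{2n+1}(S_2(X)/O(n))$, is represented by the closed $(2n+1)$-form on $S_2(X)/O(n)$ that in the coordinates $y^i,y^{ij},y^i_{jk}$ is written as $$-\tfrac12\,y_{ij}\,dy^{ij}\wedge\big(dy^k_{kl}\wedge dy^l\big)^n .$$ -/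

import Mathlib

open scoped Manifold ContDiff Topology

namespace Losik

noncomputable section

/-! ### Wedge products and pullbacks of differential forms on a normed space -/

section Forms

variable {V W : Type*} [NormedAddCommGroup V] [NormedSpace ℝ V]
  [NormedAddCommGroup W] [NormedSpace ℝ W]

theorem continuous_wedge {k l : ℕ} (α : V [⋀^Fin k]→L[ℝ] ℝ) (β : V [⋀^Fin l]→L[ℝ] ℝ) :
    Continuous ((LinearMap.mul' ℝ ℝ).compAlternatingMap
      (α.toAlternatingMap.domCoprod β.toAlternatingMap)) := by
  have h : ((LinearMap.mul' ℝ ℝ).compAlternatingMap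
      (α.toAlternatingMap.domCoprod β.toAlternatingMap) : (Fin k ⊕ Fin l → V) → ℝ) =
      fun v => ∑ σ : Equiv.Perm.ModSumCongr (Fin k) (Fin l), LinearMap.mul' ℝ ℝ
        (AlternatingMap.domCoprod.summand α.toAlternatingMap β.toAlternatingMap σ v) := by
    funext v
    simp [AlternatingMap.domCoprod_apply]
  rw [h]
  refine continuous_finsetSum _ fun σ _ => ?_
  induction σ using Quotient.inductionOn' with
  | h σ =>
    have h2 : (fun v : Fin k ⊕ Fin l → V => LinearMap.mul' ℝ ℝ
        (AlternatingMap.domCoprod.summand α.toAlternatingMap β.toAlternatingMap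
          (Quotient.mk'' σ) v)) = fun v => Equiv.Perm.sign σ •
          (α (fun i => v (σ (Sum.inl i))) * β (fun i => v (σ (Sum.inr i)))) := by
      funext v
      rw [AlternatingMap.domCoprod.summand_mk'', _root_.smul_apply,
        MultilinearMap.domDomCongr_apply, MultilinearMap.domCoprod_apply,
        Units.smul_def, Units.smul_def, map_zsmul, LinearMap.mul'_apply]
      rfl
    rw [h2]
    refine Continuous.const_smul (Continuous.mul ?_ ?_) _
    · exact α.cont.comp (by fun_prop)
    · exact β.cont.comp (by fun_prop)

/-- The wedge product (sum over shuffles, so that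
`(α ∧ β) (u, v) = α u * β v - α v * β u` for 1-forms). -/
def wedge {k l : ℕ} (α : V [⋀^Fin k]→L[ℝ] ℝ) (β : V [⋀^Fin l]→L[ℝ] ℝ) :
    V [⋀^Fin (k + l)]→L[ℝ] ℝ :=
  { ((LinearMap.mul' ℝ ℝ).compAlternatingMap
      (α.toAlternatingMap.domCoprod β.toAlternatingMap)).domDomCongr finSumFinEquiv with
    cont := (continuous_wedge α β).comp (by fun_prop :
      Continuous fun (v : Fin (k + l) → V) (i : Fin k ⊕ Fin l) => v (finSumFinEquiv i)) }

/-- A continuous linear functional as a 1-form. -/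
def oneForm (L : V →L[ℝ] ℝ) : V [⋀^Fin 1]→L[ℝ] ℝ :=
  ContinuousAlternatingMap.ofSubsingleton ℝ V ℝ (0 : Fin 1) L

/-- The power `w ∧ ⋯ ∧ w` (`m` factors) of a 2-form. -/
def wedgePow (w : V [⋀^Fin 2]→L[ℝ] ℝ) : (m : ℕ) → V [⋀^Fin (2 * m)]→L[ℝ] ℝ
  | 0 => ContinuousAlternatingMap.constOfIsEmpty ℝ V (Fin 0) 1
  | m + 1 => wedge (wedgePow w m) w

/-- A `k`-form regarded as an `l`-form when `k = l`. -/
def castDegree {k l : ℕ} (h : k = l) (α : V [⋀^Fin k]→L[ℝ] ℝ) : V [⋀^Fin l]→L[ℝ] ℝ :=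
  { α.toAlternatingMap.domDomCongr (finCongr h) with
    cont := α.cont.comp (by fun_prop :
      Continuous fun (v : Fin l → V) (i : Fin k) => v (finCongr h i)) }

/-- The form `α ∧ w ^ m` of degree `2 m + 1`, for a 1-form `α` and a 2-form `w`. -/
def wedgeWithPow (α : V [⋀^Fin 1]→L[ℝ] ℝ) (w : V [⋀^Fin 2]→L[ℝ] ℝ) (m : ℕ) :
    V [⋀^Fin (2 * m + 1)]→L[ℝ] ℝ :=
  castDegree (Nat.add_comm 1 (2 * m)) (wedge α (wedgePow w m))

/-- The pullback `F^* w` of a differential form. -/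
def pullback {k : ℕ} (F : V → W) (w : W → W [⋀^Fin k]→L[ℝ] ℝ) : V → V [⋀^Fin k]→L[ℝ] ℝ :=
  fun x => (w (F x)).compContinuousLinearMap (fderiv ℝ F x)

end Forms

/-! ### Second order frames over open subsets of `ℝⁿ` -/

/-- The model space `ℝⁿ`. -/
abbrev E (n : ℕ) := EuclideanSpace ℝ (Fin n)

/-- The `i`-th standard basis vector. -/
abbrev e {n : ℕ} (i : Fin n) : E n := EuclideanSpace.single i 1

/-- Symmetric arrays `(y^{ij})`. -/
def symMat (n : ℕ) : Submodule ℝ (Fin n → Fin n → ℝ) where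
  carrier := {g | ∀ i j, g i j = g j i}
  add_mem' ha hb i j := by simp [ha i j, hb i j]
  zero_mem' i j := rfl
  smul_mem' r a ha i j := by simp [ha i j]

/-- Arrays `(y^i_{jk})` symmetric in `j, k`. -/
def symTen (n : ℕ) : Submodule ℝ (Fin n → Fin n → Fin n → ℝ) where
  carrier := {c | ∀ i j k, c i j k = c i k j}
  add_mem' ha hb i j k := by simp [ha i j k, hb i j k]
  zero_mem' i j k := rfl
  smul_mem' r a ha i j k := by simp [ha i j k]

/-- Symmetrization in the two lower indices. It is only applied to arrays that are already
symmetric in the cases of interest (second derivatives of smooth maps), where it does nothing. -/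
def symmetrize {n : ℕ} (c : Fin n → Fin n → Fin n → ℝ) : symTen n :=
  ⟨fun i j k => (c i j k + c i k j) / 2, fun i j k => by simp only [add_comm]⟩

theorem symmetrize_of_symm {n : ℕ} {c : Fin n → Fin n → Fin n → ℝ}
    (h : ∀ i j k, c i j k = c i k j) : (symmetrize c : Fin n → Fin n → Fin n → ℝ) = c := by
  funext i j k
  simp [symmetrize, ← h i j k]

/-- The space of the coordinates `(y^i, y^i_j, y^i_{jk})` of second order frames. -/
abbrev Frame (n : ℕ) := E n × (Fin n → Fin n → ℝ) × symTen n

/-- The space of the coordinates `(y^i, y^{ij}, y^i_{jk})` of second order frames modulo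
`O(n)`. -/
abbrev RedFrame (n : ℕ) := E n × symMat n × symTen n

/-- The space `S₂(U)` in the coordinates `(y^i, y^i_j, y^i_{jk})`. -/
def frames {n : ℕ} (U : Set (E n)) : Set (Frame n) :=
  {s | s.1 ∈ U ∧ (Matrix.of s.2.1).det ≠ 0}

/-- The space `S₂(U) / O(n)` in the coordinates `(y^i, y^{ij}, y^i_{jk})`. -/
def redFrames {n : ℕ} (U : Set (E n)) : Set (RedFrame n) :=
  {x | x.1 ∈ U ∧ (Matrix.of (x.2.1 : Fin n → Fin n → ℝ)).PosDef}

/-- The Jacobian matrix `∂h^i/∂y^p`. -/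
def jac {n : ℕ} (h : E n → E n) (y : E n) : Matrix (Fin n) (Fin n) ℝ :=
  Matrix.of fun i p => fderiv ℝ h y (e p) i

/-- The second partial derivatives `∂²h^i/∂y^p∂y^q`. -/
def hess {n : ℕ} (h : E n → E n) (y : E n) (i p q : Fin n) : ℝ :=
  fderiv ℝ (fun x => jac h x i q) y (e p)

/-- The coordinates `(y^i, y^i_j, y^i_{jk})` of the second order frame given by the 2-jet at `0`
of a map `f` regular at `0`: with `z^i`, `z^i_j`, `z^i_{jk}` the partial derivatives of `f` at `0`
and `(v^i_j)` the inverse matrix of `(z^i_j)`, one puts `y^i = z^i`, `y^i_j = z^i_j`,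
`y^i_{jk} = v^p_j z^i_{pq} v^q_k`. -/
def frameCoord {n : ℕ} (f : E n → E n) : Frame n :=
  (f 0, fun i j => jac f 0 i j,
    symmetrize fun i j k => ∑ p, ∑ q, (jac f 0)⁻¹ p j * hess f 0 i p q * (jac f 0)⁻¹ q k)

/-- The transformation of the coordinates `y^i_{jk}` induced by a map `h`. -/
def liftConn {n : ℕ} (h : E n → E n) (y : E n) (c : symTen n) : symTen n :=
  symmetrize fun i j k =>
    (∑ p, ∑ q, (jac h y)⁻¹ p j * hess h y i p q * (jac h y)⁻¹ q k) +
      ∑ p, ∑ s, ∑ q, (jac h y)⁻¹ p j * jac h y i s * (jac h y)⁻¹ q k *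
        (c : Fin n → Fin n → Fin n → ℝ) s p q

/-- The map `S₂(U) → S₂(V)` induced by a regular map `h : U → V`. -/
def liftFrame {n : ℕ} (h : E n → E n) (s : Frame n) : Frame n :=
  (h s.1, fun i j => ∑ p, jac h s.1 i p * s.2.1 p j, liftConn h s.1 s.2.2)

theorem lift_symm {n : ℕ} (A : Matrix (Fin n) (Fin n) ℝ) (g : symMat n) :
    (fun i j => ∑ k, ∑ l, A i k * (g : Fin n → Fin n → ℝ) k l * A j l) ∈ symMat n := by
  intro i j
  beta_reduce
  rw [Finset.sum_comm]
  refine Finset.sum_congr rfl fun k _ => Finset.sum_congr rfl fun l _ => ?_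
  rw [g.2 l k]
  ring

/-- The map `S₂(U) / O(n) → S₂(V) / O(n)` induced by a regular map `h : U → V`. -/
def liftRed {n : ℕ} (h : E n → E n) (x : RedFrame n) : RedFrame n :=
  (h x.1, ⟨_, lift_symm (jac h x.1) x.2.1⟩, liftConn h x.1 x.2.2)

/-- The projection `p : S₂(U) → S₂(U) / O(n)`, `(y^i, y^i_j, y^i_{jk}) ↦
(y^i, ∑_l y^i_l y^j_l, y^i_{jk})`. -/
def proj {n : ℕ} (s : Frame n) : RedFrame n :=
  (s.1, ⟨fun i j => ∑ l, s.2.1 i l * s.2.1 j l, fun i j => by simp only [mul_comm]⟩, s.2.2)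

/-- The right action of a matrix `A` on frames, `(y^i, y^i_j, y^i_{jk}) ↦
(y^i, y^i_p A^p_j, y^i_{jk})`. -/
def act {n : ℕ} (A : Matrix (Fin n) (Fin n) ℝ) (s : Frame n) : Frame n :=
  (s.1, fun i j => ∑ p, s.2.1 i p * A p j, s.2.2)

/-! ### The coordinate formulas describe second order frames -/

theorem proj_liftFrame {n : ℕ} (h : E n → E n) (s : Frame n) :
    proj (liftFrame h s) = liftRed h (proj s) := by
  refine Prod.ext rfl (Prod.ext (Subtype.ext ?_) rfl)
  funext i j
  have h1 := congrFun (congrFun (show jac h s.1 * Matrix.of s.2.1 *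
    (jac h s.1 * Matrix.of s.2.1).transpose = jac h s.1 * (Matrix.of s.2.1 *
    (Matrix.of s.2.1).transpose) * (jac h s.1).transpose by
      simp only [Matrix.transpose_mul, Matrix.mul_assoc]) i) j
  simp only [Matrix.mul_apply, Matrix.transpose_apply, Matrix.of_apply, Finset.sum_mul] at h1
  refine Eq.trans ?_ (h1.trans Finset.sum_comm)
  simp only [proj, liftFrame, Finset.sum_mul]

/-- `S₂(U) / O(n)` is the quotient of `S₂(U)` by `O(n)`, with projection `proj`. -/
theorem proj_eq_proj_iff {n : ℕ} {U : Set (E n)} {s s' : Frame n} (hs : s ∈ frames U)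
    (hs' : s' ∈ frames U) :
    proj s = proj s' ↔ ∃ A ∈ Matrix.orthogonalGroup (Fin n) ℝ, s' = act A s := by
  have hm : ∀ t : Frame n, Matrix.of ((proj t).2.1 : Fin n → Fin n → ℝ) =
      Matrix.of t.2.1 * (Matrix.of t.2.1).transpose := by
    intro t
    ext i j
    simp [proj, Matrix.mul_apply]
  have hu : IsUnit (Matrix.of s.2.1).det := isUnit_iff_ne_zero.2 hs.2
  have hu' : IsUnit (Matrix.of s'.2.1).det := isUnit_iff_ne_zero.2 hs'.2
  constructor
  · intro h
    have h1 : s.1 = s'.1 := congrArg (fun x : RedFrame n => x.1) h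
    have h2 : s.2.2 = s'.2.2 := congrArg (fun x : RedFrame n => x.2.2) h
    have h3 : Matrix.of s.2.1 * (Matrix.of s.2.1).transpose =
        Matrix.of s'.2.1 * (Matrix.of s'.2.1).transpose := by
      rw [← hm, ← hm, h]
    refine ⟨(Matrix.of s.2.1)⁻¹ * Matrix.of s'.2.1, ?_, ?_⟩
    · rw [Matrix.mem_orthogonalGroup_iff, Matrix.transpose_mul, Matrix.mul_assoc,
        ← Matrix.mul_assoc (Matrix.of s'.2.1), ← h3, Matrix.transpose_nonsing_inv,
        Matrix.mul_assoc, Matrix.mul_nonsing_inv _ (by rwa [Matrix.det_transpose]),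
        Matrix.mul_one, Matrix.nonsing_inv_mul _ hu]
    · refine Prod.ext h1.symm (Prod.ext ?_ h2.symm)
      funext i j
      have := congrFun (congrFun (Matrix.mul_nonsing_inv_cancel_left _ (Matrix.of s'.2.1) hu) i) j
      rw [Matrix.mul_apply] at this
      exact this.symm
  · rintro ⟨A, hA, rfl⟩
    refine Prod.ext rfl (Prod.ext (Subtype.ext ?_) rfl)
    have h4 : Matrix.of (act A s).2.1 = Matrix.of s.2.1 * A := by
      ext i j
      simp [act, Matrix.mul_apply]
    have h5 := hm (act A s)
    rw [h4, Matrix.transpose_mul, Matrix.mul_assoc, ← Matrix.mul_assoc A,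
      (Matrix.mem_orthogonalGroup_iff _ _).1 hA, Matrix.one_mul, ← hm s] at h5
    exact Matrix.of.injective h5.symm

open scoped MatrixOrder Matrix.Norms.L2Operator in
theorem image_proj {n : ℕ} (U : Set (E n)) : proj '' frames U = redFrames U := by
  have hm : ∀ t : Frame n, Matrix.of ((proj t).2.1 : Fin n → Fin n → ℝ) =
      Matrix.of t.2.1 * (Matrix.of t.2.1).transpose := by
    intro t
    ext i j
    simp [proj, Matrix.mul_apply]
  ext x
  constructor
  · rintro ⟨s, hs, rfl⟩
    refine ⟨hs.1, ?_⟩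
    rw [hm, ← Matrix.conjTranspose_eq_transpose_of_trivial]
    refine Matrix.PosDef.mul_conjTranspose_self _ ?_
    exact Matrix.vecMul_injective_of_isUnit
      ((Matrix.isUnit_iff_isUnit_det _).2 (isUnit_iff_ne_zero.2 hs.2))
  · intro hx
    obtain ⟨B, h⟩ := CStarAlgebra.nonneg_iff_eq_star_mul_self.mp hx.2.posSemidef.nonneg
    refine ⟨(x.1, fun i j => B j i, x.2.2), ⟨hx.1, ?_⟩, ?_⟩
    · have : Matrix.of (fun i j => B j i) = B.transpose := rfl
      show (Matrix.of (fun i j => B j i)).det ≠ 0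
      rw [this, Matrix.det_transpose]
      intro h0
      have h1 := hx.2.det_pos
      rw [h, Matrix.det_mul, h0, mul_zero] at h1
      exact lt_irrefl _ h1
    · refine Prod.ext rfl (Prod.ext (Subtype.ext ?_) rfl)
      refine Matrix.of.injective ?_
      rw [hm, h, Matrix.star_eq_conjTranspose, Matrix.conjTranspose_eq_transpose_of_trivial]
      rfl

theorem jac_comp {n : ℕ} {f h : E n → E n} {x : E n} (hf : DifferentiableAt ℝ f x)
    (hh : DifferentiableAt ℝ h (f x)) : jac (h ∘ f) x = jac h (f x) * jac f x := by
  ext i p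
  have hv : fderiv ℝ f x (e p) = ∑ s, fderiv ℝ f x (e p) s • (e s : E n) := by
    ext s
    simp [e, Pi.single_apply]
  simp only [jac, Matrix.of_apply, Matrix.mul_apply, fderiv_comp x hh hf,
    ContinuousLinearMap.comp_apply]
  conv_lhs => rw [hv]
  simp [mul_comm]

theorem contDiffAt_jac {n : ℕ} {f : E n → E n} {x : E n} (hf : ContDiffAt ℝ ∞ f x)
    (i p : Fin n) : DifferentiableAt ℝ (fun y => jac f y i p) x := by
  have h1 : ContDiffAt ℝ 1 (fderiv ℝ f) x := hf.fderiv_right (by norm_cast)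
  have h2 := (h1.differentiableAt one_ne_zero).clm_apply (differentiableAt_const (e p))
  exact (EuclideanSpace.proj (𝕜 := ℝ) i).differentiableAt.comp x h2

/-- Second partial derivatives of a smooth map are symmetric. -/
theorem hess_symm {n : ℕ} {f : E n → E n} {x : E n} (hf : ContDiffAt ℝ ∞ f x) (i p q : Fin n) :
    hess f x i p q = hess f x i q p := by
  have h1 : ContDiffAt ℝ 1 (fderiv ℝ f) x := hf.fderiv_right (by norm_cast)
  have h2 := h1.differentiableAt one_ne_zero
  have key : ∀ p q, hess f x i p q = fderiv ℝ (fderiv ℝ f) x (e p) (e q) i := by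
    intro p q
    have h3 := (h2.hasFDerivAt.clm_apply (hasFDerivAt_const (e q) x))
    have h4 := ((EuclideanSpace.proj (𝕜 := ℝ) i).hasFDerivAt.comp x h3).fderiv
    unfold hess jac
    have h5 : (fun y : E n => Matrix.of (fun i p => fderiv ℝ f y (e p) i) i q) =
      (EuclideanSpace.proj (𝕜 := ℝ) i) ∘ fun y => fderiv ℝ f y (e q) := rfl
    rw [h5, h4]
    simp
  rw [key, key, (hf.isSymmSndFDerivAt (by simpa using! (WithTop.coe_le_coe.2 (le_top : (2 : ℕ∞) ≤ ⊤)))).eq]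

theorem hess_comp {n : ℕ} {f h : E n → E n} {x : E n} (hf : ContDiffAt ℝ ∞ f x)
    (hh : ContDiffAt ℝ ∞ h (f x)) (i p q : Fin n) :
    hess (h ∘ f) x i p q = (∑ a, ∑ b, hess h (f x) i a b * jac f x a p * jac f x b q) +
      ∑ s, jac h (f x) i s * hess f x s p q := by
  have h1 : (fun y => jac (h ∘ f) y i q) =ᶠ[𝓝 x]
      fun y => ∑ s, jac h (f y) i s * jac f y s q := by
    have e1 : ∀ᶠ y in 𝓝 x, DifferentiableAt ℝ f y :=
      ((hf.of_le (m := 1) (by norm_cast)).eventually (by norm_cast)).mono fun y hy =>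
        hy.differentiableAt one_ne_zero
    have e2 : ∀ᶠ y in 𝓝 x, DifferentiableAt ℝ h (f y) :=
      hf.continuousAt.eventually
        (((hh.of_le (m := 1) (by norm_cast)).eventually (by norm_cast)).mono fun y hy =>
          hy.differentiableAt one_ne_zero)
    filter_upwards [e1, e2] with y hy1 hy2
    rw [jac_comp hy1 hy2, Matrix.mul_apply]
  have hfd : DifferentiableAt ℝ f x := hf.differentiableAt (by simp)
  have hd : ∀ s, HasFDerivAt (fun y => jac h (f y) i s * jac f y s q) _ x := fun s =>
    (((contDiffAt_jac hh i s).hasFDerivAt.comp x hfd.hasFDerivAt).mul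
      (contDiffAt_jac hf s q).hasFDerivAt)
  have hv : fderiv ℝ f x (e p) = ∑ a, jac f x a p • (e a : E n) := by
    ext a
    simp [e, jac, Pi.single_apply]
  unfold hess
  rw [h1.fderiv_eq, (HasFDerivAt.fun_sum fun s _ => hd s).fderiv]
  simp only [_root_.sum_apply, _root_.add_apply, _root_.smul_apply,
    ContinuousLinearMap.comp_apply, smul_eq_mul, hv, map_sum, map_smul]
  rw [Finset.sum_add_distrib, add_comm]
  congr 1
  simp only [Finset.mul_sum]
  rw [Finset.sum_comm]
  exact Finset.sum_congr rfl fun a _ => Finset.sum_congr rfl fun b _ => by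
    ring

/-- The map induced by `h` sends the second order frame of `f` to the one of `h ∘ f`. -/
theorem liftFrame_frameCoord {n : ℕ} {f h : E n → E n} (hf : ContDiffAt ℝ ∞ f 0)
    (hh : ContDiffAt ℝ ∞ h (f 0)) (hf' : IsUnit (jac f 0)) :
    liftFrame h (frameCoord f) = frameCoord (h ∘ f) := by
  have hj : jac (h ∘ f) 0 = jac h (f 0) * jac f 0 :=
    jac_comp (hf.differentiableAt (by simp)) (hh.differentiableAt (by simp))
  have hF : jac f 0 * (jac f 0)⁻¹ = 1 :=
    Matrix.mul_nonsing_inv _ ((Matrix.isUnit_iff_isUnit_det _).1 hf')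
  set F := jac f 0 with hFdef
  set V := F⁻¹ with hVdef
  set J := jac h (f 0) with hJdef
  set K := J⁻¹ with hKdef
  have hinv : (jac (h ∘ f) 0)⁻¹ = V * K := by rw [hj, Matrix.mul_inv_rev]
  have hsymm : ∀ i j k, ∑ p, ∑ q, V p j * hess f 0 i p q * V q k =
      ∑ p, ∑ q, V p k * hess f 0 i p q * V q j := by
    intro i j k
    rw [Finset.sum_comm]
    refine Finset.sum_congr rfl fun p _ => Finset.sum_congr rfl fun q _ => ?_
    rw [hess_symm hf i q p]
    ring
  refine Prod.ext rfl (Prod.ext ?_ ?_)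
  · funext i j
    exact (congrFun (congrFun hj i) j).symm
  · show liftConn h (f 0) (frameCoord f).2.2 = _
    unfold liftConn frameCoord
    rw [symmetrize_of_symm hsymm, hinv]
    refine congrArg symmetrize ?_
    funext i j k
    have hFK : F * (V * K) = K := by rw [← Matrix.mul_assoc, hF, Matrix.one_mul]
    have e1 : ∀ (A B : Matrix (Fin n) (Fin n) ℝ) (H : Fin n → Fin n → ℝ),
        ∑ p, ∑ q, A p j * H p q * B q k = (A.transpose * Matrix.of H * B) j k := by
      intro A B H
      rw [Finset.sum_comm]
      simp [Matrix.mul_apply, Finset.sum_mul]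
    have e2 : Matrix.of (hess (h ∘ f) 0 i) =
        F.transpose * Matrix.of (hess h (f 0) i) * F +
          ∑ s, J i s • Matrix.of (hess f 0 s) := by
      ext p q
      rw [Matrix.of_apply, hess_comp hf hh, Matrix.add_apply, Matrix.sum_apply]
      congr 1
      rw [Finset.sum_comm]
      simp only [Matrix.mul_apply, Finset.sum_mul, Matrix.transpose_apply, Matrix.of_apply]
      exact Finset.sum_congr rfl fun b _ => Finset.sum_congr rfl fun a _ => by ring
    have e3 : ∀ s p q, ∑ p', ∑ q', V p' p * hess f 0 s p' q' * V q' q =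
        (V.transpose * Matrix.of (hess f 0 s) * V) p q := by
      intro s p q
      rw [Finset.sum_comm]
      simp [Matrix.mul_apply, Finset.sum_mul]
    rw [e1, e1, e2]
    simp only [e3]
    have e4 : ∑ p, ∑ s, ∑ q, K p j * J i s * K q k *
        (V.transpose * Matrix.of (hess f 0 s) * V) p q =
        (∑ s, J i s • (K.transpose * (V.transpose * Matrix.of (hess f 0 s) * V) * K)) j k := by
      rw [Finset.sum_comm, Matrix.sum_apply]
      refine Finset.sum_congr rfl fun s _ => ?_
      have := e1 K K fun p q => (V.transpose * Matrix.of (hess f 0 s) * V) p q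
      rw [Matrix.smul_apply, smul_eq_mul]
      refine Eq.trans ?_ (congrArg (J i s * ·) this)
      simp only [Finset.mul_sum]
      exact Finset.sum_congr rfl fun p _ => Finset.sum_congr rfl fun q _ => by ring
    rw [e4, ← Matrix.add_apply]
    refine congrFun (congrFun ?_ j) k
    show K.transpose * Matrix.of (hess h (f 0) i) * K + _ = _
    rw [Matrix.mul_add, Matrix.add_mul]
    congr 1
    · rw [show (V * K).transpose * (F.transpose * Matrix.of (hess h (f 0) i) * F) * (V * K) =
        (F * (V * K)).transpose * Matrix.of (hess h (f 0) i) * (F * (V * K)) by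
          simp only [Matrix.transpose_mul, Matrix.mul_assoc], hFK]
    · rw [Matrix.mul_sum, Matrix.sum_mul]
      refine Finset.sum_congr rfl fun s _ => ?_
      simp only [Matrix.mul_smul, Matrix.smul_mul, Matrix.transpose_mul, Matrix.mul_assoc]

/-! ### The forms -/

/-- The coordinate differential `dy^k` on frames or reduced frames. -/
def dBase {n : ℕ} {G : Type*} [NormedAddCommGroup G] [NormedSpace ℝ G] (k : Fin n) :
    E n × G × symTen n →L[ℝ] ℝ :=
  EuclideanSpace.proj k ∘L ContinuousLinearMap.fst ℝ (E n) (G × symTen n)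

/-- The coordinate differential `dy^i_{jk}` on frames or reduced frames. -/
def dConn {n : ℕ} {G : Type*} [NormedAddCommGroup G] [NormedSpace ℝ G] (i j k : Fin n) :
    E n × G × symTen n →L[ℝ] ℝ :=
  ContinuousLinearMap.proj (R := ℝ) (φ := fun _ : Fin n => ℝ) k ∘L
    ContinuousLinearMap.proj (R := ℝ) (φ := fun _ : Fin n => Fin n → ℝ) j ∘L
    ContinuousLinearMap.proj (R := ℝ) (φ := fun _ : Fin n => Fin n → Fin n → ℝ) i ∘L
    (symTen n).subtypeL ∘L ContinuousLinearMap.snd ℝ G (symTen n) ∘L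
    ContinuousLinearMap.snd ℝ (E n) (G × symTen n)

/-- The coordinate differential `dy^i_j` on frames. -/
def dFrame {n : ℕ} (i j : Fin n) : Frame n →L[ℝ] ℝ :=
  ContinuousLinearMap.proj (R := ℝ) (φ := fun _ : Fin n => ℝ) j ∘L
    ContinuousLinearMap.proj (R := ℝ) (φ := fun _ : Fin n => Fin n → ℝ) i ∘L
    ContinuousLinearMap.fst ℝ (Fin n → Fin n → ℝ) (symTen n) ∘L
    ContinuousLinearMap.snd ℝ (E n) ((Fin n → Fin n → ℝ) × symTen n)

/-- The coordinate differential `dy^{ij}` on reduced frames. -/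
def dMetric {n : ℕ} (i j : Fin n) : RedFrame n →L[ℝ] ℝ :=
  ContinuousLinearMap.proj (R := ℝ) (φ := fun _ : Fin n => ℝ) j ∘L
    ContinuousLinearMap.proj (R := ℝ) (φ := fun _ : Fin n => Fin n → ℝ) i ∘L
    (symMat n).subtypeL ∘L ContinuousLinearMap.fst ℝ (symMat n) (symTen n) ∘L
    ContinuousLinearMap.snd ℝ (E n) (symMat n × symTen n)

/-- The 1-form `Γ₁ = - v^i_k dy^k_i + y^i_{ik} dy^k` on second order frames, `(v^i_j)` being the
inverse of `(y^i_j)`. -/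
def Gamma1 (n : ℕ) (s : Frame n) : Frame n [⋀^Fin 1]→L[ℝ] ℝ :=
  oneForm (-(∑ i, ∑ k, (Matrix.of s.2.1)⁻¹ i k • dFrame k i) +
    ∑ k, ∑ i, (s.2.2 : Fin n → Fin n → Fin n → ℝ) i i k • dBase k)

/-- The 1-form `-1/2 y_{ij} dy^{ij}` on reduced frames, `(y_{ij})` being the inverse of
`(y^{ij})`. -/
def metricForm (n : ℕ) (x : RedFrame n) : RedFrame n [⋀^Fin 1]→L[ℝ] ℝ :=
  oneForm (-(1 / 2 : ℝ) •
    ∑ i, ∑ j, (Matrix.of (x.2.1 : Fin n → Fin n → ℝ))⁻¹ i j • dMetric i j)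

/-- The 1-form `Λ₁ = -1/2 y_{ij} dy^{ij} + y^j_{jk} dy^k` on reduced frames. -/
def Lambda1 (n : ℕ) (x : RedFrame n) : RedFrame n [⋀^Fin 1]→L[ℝ] ℝ :=
  metricForm n x + oneForm (∑ k, ∑ j, (x.2.2 : Fin n → Fin n → Fin n → ℝ) j j k • dBase k)

/-- The (constant) 2-form `dy^k_{kl} ∧ dy^l` on frames or reduced frames. -/
def curvForm (n : ℕ) (G : Type*) [NormedAddCommGroup G] [NormedSpace ℝ G] :
    (E n × G × symTen n) [⋀^Fin 2]→L[ℝ] ℝ :=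
  ∑ l, ∑ k, wedge (oneForm (dConn k k l)) (oneForm (dBase l))

/-- The form `Λ₁ ∧ (dΛ₁)^n`. -/
def gvlForm (n : ℕ) (x : RedFrame n) : RedFrame n [⋀^Fin (2 * n + 1)]→L[ℝ] ℝ :=
  wedgeWithPow (Lambda1 n x) (extDeriv (Lambda1 n) x) n

/-- The form `-1/2 y_{ij} dy^{ij} ∧ (dy^k_{kl} ∧ dy^l)^n`. -/
def gvlCoordForm (n : ℕ) (x : RedFrame n) : RedFrame n [⋀^Fin (2 * n + 1)]→L[ℝ] ℝ :=
  wedgeWithPow (metricForm n x) (curvForm n (symMat n)) n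

/-! ### The canonical Gelfand-Kazhdan form -/

/-- For a smooth family `k_u = k (u, ·)` of maps regular at `0` and a local inverse `φ` of `k_0`,
the germ at `0` of the vector field `- d/du (k_0⁻¹ ∘ k_u)` at `u = 0`, i.e. the value of the
canonical form on the tangent vector represented by the family. -/
def gkField {n : ℕ} (k : ℝ × E n → E n) (φ : E n → E n) (t : E n) : E n :=
  -deriv (fun u : ℝ => φ (k (u, t))) 0

/-- The component `θ^i_j` of the canonical form: the first partial derivative `∂_j` at `0` of the
`i`-th component of the vector field. -/
def gkTheta {n : ℕ} (k : ℝ × E n → E n) (φ : E n → E n) (i j : Fin n) : ℝ :=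
  jac (gkField k φ) 0 i j

/-! ### Quotients `X = M / P` and the de Rham cohomology of `S₂(X) / O(n)` -/

section Quotient

variable (n : ℕ) (M : Type*) [TopologicalSpace M] [ChartedSpace (E n) M]

/-- The coordinate systems of the smooth manifold `M`. -/
abbrev Chart := IsManifold.maximalAtlas (𝓡 n) ∞ M

variable {M}

variable {n} in
/-- The expression of a local homeomorphism `h` of `M` in the coordinates `φ`, `ψ`. -/
def localRep (h : OpenPartialHomeomorph M M) (φ ψ : Chart n M) :
    OpenPartialHomeomorph (E n) (E n) :=
  (φ : OpenPartialHomeomorph M (E n)).symm ≫ₕ (h ≫ₕ (ψ : OpenPartialHomeomorph M (E n)))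

/-- A family of local expressions `w_φ`, one for each coordinate system `φ` of `M`, each considered
as a function on the whole coordinate space. -/
abbrev LocalForms (_P : StructureGroupoid M) (k : ℕ) :=
  Chart n M → RedFrame n → RedFrame n [⋀^Fin k]→L[ℝ] ℝ

variable {n} in
theorem isOpen_redFrames {U : Set (E n)} (hU : IsOpen U) : IsOpen (redFrames U) := by
  have key : redFrames U = {x : RedFrame n | x.1 ∈ U} ∩
      {x : RedFrame n | ∀ v ∈ Metric.sphere (0 : E n) 1,
        0 < ∑ i, ∑ j, v i * (x.2.1 : Fin n → Fin n → ℝ) i j * v j} := by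
    ext x
    simp only [redFrames, Set.mem_ofPred_eq, Set.mem_inter_iff]
    refine and_congr_right fun _ => ?_
    have hq : ∀ v : Fin n → ℝ, star v ⬝ᵥ
        (Matrix.of (x.2.1 : Fin n → Fin n → ℝ)).mulVec v =
        ∑ i, ∑ j, v i * (x.2.1 : Fin n → Fin n → ℝ) i j * v j := by
      intro v
      simp [dotProduct, Matrix.mulVec, Finset.mul_sum, mul_assoc]
    rw [Matrix.posDef_iff_dotProduct_mulVec]
    constructor
    · rintro ⟨-, h⟩ v hv
      have hv0 : v.ofLp ≠ 0 := by
        intro h0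
        have : v = 0 := by ext i; exact congrFun h0 i
        simp [this] at hv
      rw [← hq]
      exact h hv0
    · intro h
      refine ⟨?_, fun v hv => ?_⟩
      · ext i j
        simpa using x.2.1.2 j i
      · rw [hq]
        have hw : ‖WithLp.toLp 2 v‖ ≠ 0 := by
          rw [norm_ne_zero_iff]
          intro h0
          exact hv (congrArg WithLp.ofLp h0)
        have hpos : 0 < ‖WithLp.toLp 2 v‖ := lt_of_le_of_ne (norm_nonneg _) (Ne.symm hw)
        have := h (‖WithLp.toLp 2 v‖⁻¹ • WithLp.toLp 2 v) (by simp [norm_smul, hw])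
        have h3 : ∑ i, ∑ j, v i * (x.2.1 : Fin n → Fin n → ℝ) i j * v j =
            ‖WithLp.toLp 2 v‖ ^ 2 * ∑ i, ∑ j, (‖WithLp.toLp 2 v‖⁻¹ • WithLp.toLp 2 v) i *
              (x.2.1 : Fin n → Fin n → ℝ) i j * (‖WithLp.toLp 2 v‖⁻¹ • WithLp.toLp 2 v) j := by
          simp only [Finset.mul_sum, PiLp.smul_apply, smul_eq_mul]
          refine Finset.sum_congr rfl fun i _ => Finset.sum_congr rfl fun j _ => ?_
          field_simp
        rw [h3]
        positivity
  rw [key]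
  refine (hU.preimage continuous_fst).inter ?_
  rw [isOpen_iff_eventually]
  intro x hx
  refine (isCompact_sphere (0 : E n) 1).eventually_forall_of_forall_eventually fun v hv => ?_
  have hc : Continuous fun z : RedFrame n × E n =>
      ∑ i, ∑ j, z.2 i * (z.1.2.1 : Fin n → Fin n → ℝ) i j * z.2 j := by
    refine continuous_finsetSum _ fun i _ => continuous_finsetSum _ fun j _ => ?_
    have h1 : Continuous fun z : RedFrame n × E n => (z.1.2.1 : Fin n → Fin n → ℝ) i j :=
      (continuous_apply j).comp ((continuous_apply i).comp
        (continuous_subtype_val.comp (continuous_fst.comp (continuous_snd.comp continuous_fst))))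
    exact (Continuous.mul (by fun_prop) h1).mul (by fun_prop)
  exact hc.continuousAt.eventually (lt_mem_nhds (hx v hv))

/-- The smooth `k`-forms on `S₂(X) / O(n)`, `X = M / P`, i.e. the `P`-invariant smooth `k`-forms
on `S₂(M) / O(n)`. Such a form is given by its expressions in the coordinates
`(y^i, y^{ij}, y^i_{jk})` over all the coordinate systems of `M` (normalized to be `0` outside the
coordinate domains); invariance under `id ∈ P` says that these agree on overlaps. -/
def redForms (P : StructureGroupoid M) (k : ℕ) : Submodule ℝ (LocalForms n P k) where
  carrier := {w |
    (∀ φ : Chart n M, ContDiffOn ℝ ∞ (w φ) (redFrames φ.1.target)) ∧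
    (∀ φ : Chart n M, ∀ x ∉ redFrames φ.1.target, w φ x = 0) ∧
    ∀ h ∈ P, ∀ φ ψ : Chart n M,
      Set.EqOn (pullback (liftRed (localRep h φ ψ)) (w ψ)) (w φ)
        (redFrames (localRep h φ ψ).source)}
  add_mem' {a b} ha hb := by
    refine ⟨fun φ => (ha.1 φ).add (hb.1 φ), fun φ x hx => ?_, fun h hh φ ψ x hx => ?_⟩
    · simp [ha.2.1 φ x hx, hb.2.1 φ x hx]
    · have h1 := ha.2.2 h hh φ ψ hx
      have h2 := hb.2.2 h hh φ ψ hx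
      simp only [Pi.add_apply, ← h1, ← h2]
      rfl
  zero_mem' := by
    refine ⟨fun φ => contDiffOn_const, fun φ x hx => rfl, fun h hh φ ψ x hx => rfl⟩
  smul_mem' r a ha := by
    refine ⟨fun φ => (ha.1 φ).const_smul r, fun φ x hx => ?_, fun h hh φ ψ x hx => ?_⟩
    · simp [ha.2.1 φ x hx]
    · have h1 := ha.2.2 h hh φ ψ hx
      simp only [Pi.smul_apply, ← h1]
      rfl

variable {n} in
theorem redForms.differentiableAt {P : StructureGroupoid M} {k : ℕ} {w : LocalForms n P k}
    (hw : w ∈ redForms n P k) {φ : Chart n M} {x : RedFrame n} (hx : x ∈ redFrames φ.1.target) :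
    DifferentiableAt ℝ (w φ) x :=
  ((hw.1 φ).contDiffAt ((isOpen_redFrames φ.1.open_target).mem_nhds hx)).differentiableAt
    (by simp)

/-- The closed `k`-forms on `S₂(X) / O(n)`. -/
def closedForms (P : StructureGroupoid M) (k : ℕ) : Submodule ℝ (LocalForms n P k) where
  carrier := {w | w ∈ redForms n P k ∧
    ∀ φ : Chart n M, ∀ x ∈ redFrames φ.1.target, extDeriv (w φ) x = 0}
  add_mem' {a b} ha hb := by
    refine ⟨add_mem ha.1 hb.1, fun φ x hx => ?_⟩
    rw [Pi.add_apply, extDeriv_add (redForms.differentiableAt ha.1 hx)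
      (redForms.differentiableAt hb.1 hx), ha.2 φ x hx, hb.2 φ x hx, add_zero]
  zero_mem' := by
    refine ⟨zero_mem _, fun φ x hx => ?_⟩
    have h : (0 : RedFrame n → RedFrame n [⋀^Fin k]→L[ℝ] ℝ) =
      (0 : ℝ) • (0 : RedFrame n → RedFrame n [⋀^Fin k]→L[ℝ] ℝ) := (zero_smul _ _).symm
    rw [Pi.zero_apply, h, extDeriv_smul, zero_smul]
  smul_mem' r a ha := by
    refine ⟨Submodule.smul_mem _ r ha.1, fun φ x hx => ?_⟩
    rw [Pi.smul_apply, extDeriv_smul, ha.2 φ x hx, smul_zero]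

/-- The exact `k`-forms on `S₂(X) / O(n)`: those that are the exterior derivative of a
`(k - 1)`-form on `S₂(X) / O(n)`. -/
def exactForms (P : StructureGroupoid M) : (k : ℕ) → Submodule ℝ (LocalForms n P k)
  | 0 => ⊥
  | k + 1 =>
    { carrier := {w | w ∈ redForms n P (k + 1) ∧ ∃ η ∈ redForms n P k,
        ∀ φ : Chart n M, ∀ x ∈ redFrames φ.1.target, w φ x = extDeriv (η φ) x}
      add_mem' := by
        rintro a b ⟨ha, η, hη, h1⟩ ⟨hb, ξ, hξ, h2⟩
        refine ⟨add_mem ha hb, η + ξ, add_mem hη hξ, fun φ x hx => ?_⟩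
        rw [Pi.add_apply η ξ, extDeriv_add (redForms.differentiableAt hη hx)
          (redForms.differentiableAt hξ hx), ← h1 φ x hx, ← h2 φ x hx]
        rfl
      zero_mem' := by
        refine ⟨zero_mem _, 0, zero_mem _, fun φ x hx => ?_⟩
        exact ((zero_mem (closedForms n P k)).2 φ x hx).symm
      smul_mem' := by
        rintro r a ⟨ha, η, hη, h1⟩
        refine ⟨Submodule.smul_mem _ r ha, r • η, Submodule.smul_mem _ r hη, fun φ x hx => ?_⟩
        rw [Pi.smul_apply r η, extDeriv_smul, ← h1 φ x hx]
        rfl }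

set_option maxSynthPendingDepth 5 in
/-- The de Rham cohomology `H^k(S₂(X) / O(n))`: closed forms modulo exact forms. -/
abbrev deRham (P : StructureGroupoid M) (k : ℕ) :=
  closedForms n P k ⧸ (exactForms n P k).submoduleOf (closedForms n P k)

variable {n} in
set_option maxSynthPendingDepth 5 in
/-- The closed form `w` represents the cohomology class `c`. -/
def Represents {P : StructureGroupoid M} {k : ℕ} (w : LocalForms n P k) (c : deRham n P k) : Prop :=
  ∃ hw : w ∈ closedForms n P k, Submodule.Quotient.mk ⟨w, hw⟩ = c

variable {n} in
/-- The family that is given by one and the same coordinate expression `w` in every coordinate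
system. -/
def ofCoord (P : StructureGroupoid M) {k : ℕ} (w : RedFrame n → RedFrame n [⋀^Fin k]→L[ℝ] ℝ) :
    LocalForms n P k :=
  fun φ => (redFrames φ.1.target).indicator w

end Quotient

end

end Losik

open Losik

/-!
The proof rests on the standard contact form `dt + p_k dy^k` on `ℝ × T^*ℝⁿ`. By Jacobi's formula
`hasFDerivAt_log_det`, the form `-1/2 y_{ij} dy^{ij}` is the differential of the potential `-1/2
log det (y^{ij})`, and `-v^i_k dy^k_i` is the differential of `-log |det (y^i_j)|`. Hence `Λ₁` and
`Γ₁` are the pullbacks of the contact form by the maps `toContact f : (y, g, c) ↦ (f g, y,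
y^j_{jk})`, where `f` is the respective potential (`Lambda1_eq`, `Gamma1_eq`). The potentials
correspond to each other under `p`, because `det (Y Yᵀ) = (det Y)²`, and so `p^* Λ₁ = Γ₁`. Both
exterior derivatives are the pullback of the symplectic form `dp_k ∧ dy^k`, which is `dy^k_{kl} ∧
dy^l`.

`Λ₁` is canonical because a regular map `h` with Jacobian matrix `J` changes the potential by
`-log |det J|`, while the trace `y^j_{jk}` changes by the partial derivatives of `log |det J|`
(`trace_liftConn`): the two changes cancel in `dt + p_k dy^k`. Exterior derivatives and wedge
products of canonical forms are canonical, and the coordinate expression of an element of a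
pseudogroup is a regular map, so that a smooth canonical form defines a form on `S₂(M / P) /
O(n)`.

For the Gelfand-Kazhdan form, put `F_u = φ ∘ k_u`. By the symmetry of mixed derivatives the trace
of the first order part of `-dF_u/du` is minus the derivative of the trace of the Jacobian matrix
of `F_u` at `0`, which the chain rule computes; the second derivatives of `φ` are eliminated by
`trace_frameCoord`, the consequence of `φ ∘ k_0 = id` for the second derivatives.

Finally `Λ₁ ∧ (dΛ₁)^n` and `-1/2 y_{ij} dy^{ij} ∧ (dy^k_{kl} ∧ dy^l)^n` coincide as forms. Their
difference is the pullback of `p_k dy^k ∧ (dp_k ∧ dy^k)^n`, a form of degree `2 n + 1` coming from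
the `2 n`-dimensional space `T^*ℝⁿ`, so it vanishes (`wedgeWithPow_liouville_eq_zero`). The second
form is closed since it is the pullback of the constant form `dt ∧ (dp_k ∧ dy^k)^n`.
-/

namespace Losik

/-! ### Algebra of the wedge product -/

section WedgeAlgebra

variable {V W : Type*} [NormedAddCommGroup V] [NormedSpace ℝ V]
  [NormedAddCommGroup W] [NormedSpace ℝ W]

theorem wedge_apply {k l : ℕ} (α : V [⋀^Fin k]→L[ℝ] ℝ) (β : V [⋀^Fin l]→L[ℝ] ℝ)
    (v : Fin (k + l) → V) :
    wedge α β v = LinearMap.mul' ℝ ℝ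
      ((α.toAlternatingMap.domCoprod β.toAlternatingMap) fun i => v (finSumFinEquiv i)) :=
  rfl

theorem wedge_compContinuousLinearMap {k l : ℕ} (α : W [⋀^Fin k]→L[ℝ] ℝ)
    (β : W [⋀^Fin l]→L[ℝ] ℝ) (L : V →L[ℝ] W) :
    (wedge α β).compContinuousLinearMap L =
      wedge (α.compContinuousLinearMap L) (β.compContinuousLinearMap L) := by
  ext v
  rw [ContinuousAlternatingMap.compContinuousLinearMap_apply, wedge_apply, wedge_apply,
    AlternatingMap.domCoprod_apply, AlternatingMap.domCoprod_apply]
  simp only [_root_.sum_apply]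
  refine congrArg _ (Finset.sum_congr rfl fun σ _ => ?_)
  induction σ using Quotient.inductionOn' with
  | h σ => rfl

theorem wedge_add_left {k l : ℕ} (α α' : V [⋀^Fin k]→L[ℝ] ℝ) (β : V [⋀^Fin l]→L[ℝ] ℝ) :
    wedge (α + α') β = wedge α β + wedge α' β := by
  ext v
  simp only [ContinuousAlternatingMap.add_apply, wedge_apply,
    ← AlternatingMap.domCoprod'_apply, ContinuousAlternatingMap.toAlternatingMap_add,
    TensorProduct.add_tmul, map_add, AlternatingMap.add_apply]

theorem wedge_smul_left {k l : ℕ} (r : ℝ) (α : V [⋀^Fin k]→L[ℝ] ℝ)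
    (β : V [⋀^Fin l]→L[ℝ] ℝ) : wedge (r • α) β = r • wedge α β := by
  ext v
  simp only [ContinuousAlternatingMap.smul_apply, wedge_apply,
    ← AlternatingMap.domCoprod'_apply, ContinuousAlternatingMap.toAlternatingMap_smul,
    ← TensorProduct.smul_tmul', map_smul, AlternatingMap.smul_apply]

@[simp]
theorem oneForm_apply (L : V →L[ℝ] ℝ) (v : Fin 1 → V) : oneForm L v = L (v 0) :=
  rfl

theorem oneForm_add (L L' : V →L[ℝ] ℝ) : oneForm (L + L') = oneForm L + oneForm L' :=
  rfl

theorem oneForm_compContinuousLinearMap (L : W →L[ℝ] ℝ) (A : V →L[ℝ] W) :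
    (oneForm L).compContinuousLinearMap A = oneForm (L ∘L A) :=
  rfl

theorem wedge_oneForm_apply (L L' : V →L[ℝ] ℝ) (v : Fin 2 → V) :
    wedge (oneForm L) (oneForm L') v = L (v 0) * L' (v 1) - L (v 1) * L' (v 0) := by
  have h := congrArg (fun f => LinearMap.mul' ℝ ℝ (f fun i => v (finSumFinEquiv i)))
    (MultilinearMap.domCoprod_alternization_eq (oneForm L).toAlternatingMap
      (oneForm L').toAlternatingMap)
  simp only [Fintype.card_fin, Nat.factorial_one, mul_one, one_smul] at h
  refine Eq.trans h.symm ?_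
  -- The sum over shuffles becomes a sum over the two permutations of `Fin 2`.
  rw [MultilinearMap.alternatization_apply, map_sum,
    ← Equiv.sum_comp finSumFinEquiv.permCongr.symm]
  rw [show (Finset.univ : Finset (Equiv.Perm (Fin (1 + 1)))) = {1, Equiv.swap 0 1} by decide,
    Finset.sum_pair (by decide)]
  simp
  exact (sub_eq_add_neg _ _).symm

theorem wedgePow_compContinuousLinearMap (w : W [⋀^Fin 2]→L[ℝ] ℝ) (L : V →L[ℝ] W) (m : ℕ) :
    (wedgePow w m).compContinuousLinearMap L = wedgePow (w.compContinuousLinearMap L) m := by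
  induction m with
  | zero => rfl
  | succ m ih => rw [wedgePow, wedge_compContinuousLinearMap, ih, wedgePow]

theorem wedgeWithPow_compContinuousLinearMap (α : W [⋀^Fin 1]→L[ℝ] ℝ)
    (w : W [⋀^Fin 2]→L[ℝ] ℝ) (m : ℕ) (L : V →L[ℝ] W) :
    (wedgeWithPow α w m).compContinuousLinearMap L =
      wedgeWithPow (α.compContinuousLinearMap L) (w.compContinuousLinearMap L) m := by
  rw [wedgeWithPow, wedgeWithPow, ← wedgePow_compContinuousLinearMap,
    ← wedge_compContinuousLinearMap]
  rfl

theorem wedgeWithPow_add_left (α α' : V [⋀^Fin 1]→L[ℝ] ℝ) (w : V [⋀^Fin 2]→L[ℝ] ℝ) (m : ℕ) :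
    wedgeWithPow (α + α') w m = wedgeWithPow α w m + wedgeWithPow α' w m := by
  rw [wedgeWithPow, wedge_add_left]
  rfl

theorem wedgeWithPow_smul_left (r : ℝ) (α : V [⋀^Fin 1]→L[ℝ] ℝ) (w : V [⋀^Fin 2]→L[ℝ] ℝ)
    (m : ℕ) : wedgeWithPow (r • α) w m = r • wedgeWithPow α w m := by
  rw [wedgeWithPow, wedge_smul_left]
  rfl

/-- There are no nonzero forms whose degree exceeds the dimension of the space. -/
theorem eq_zero_of_finrank_lt [FiniteDimensional ℝ V] {k : ℕ} (w : V [⋀^Fin k]→L[ℝ] ℝ)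
    (h : Module.finrank ℝ V < k) : w = 0 := by
  ext v
  refine w.toAlternatingMap.map_linearDependent v fun hv => ?_
  have := hv.fintype_card_le_finrank
  rw [Fintype.card_fin] at this
  exact absurd h this.not_gt

end WedgeAlgebra

/-! ### Derivatives of determinants and inverse matrices -/

section MatrixCalculus

variable {V : Type*} [NormedAddCommGroup V] [NormedSpace ℝ V] {n : ℕ}

theorem contDiffAt_det {A : V → Matrix (Fin n) (Fin n) ℝ} {x : V} {r : WithTop ℕ∞}
    (hA : ∀ i j, ContDiffAt ℝ r (fun y => A y i j) x) :
    ContDiffAt ℝ r (fun y => (A y).det) x := by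
  simp only [Matrix.det_apply, Units.smul_def, zsmul_eq_mul]
  exact ContDiffAt.sum fun σ _ => contDiffAt_const.mul (contDiffAt_prod fun i _ => hA _ _)

theorem contDiffAt_inv_apply {A : V → Matrix (Fin n) (Fin n) ℝ} {x : V} {r : WithTop ℕ∞}
    (hA : ∀ i j, ContDiffAt ℝ r (fun y => A y i j) x) (h : (A x).det ≠ 0) (i j : Fin n) :
    ContDiffAt ℝ r (fun y => (A y)⁻¹ i j) x := by
  simp only [Matrix.inv_def, Matrix.smul_apply, smul_eq_mul, Ring.inverse_eq_inv',
    Matrix.adjugate_apply]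
  refine ((contDiffAt_det hA).inv h).mul (contDiffAt_det fun a b => ?_)
  by_cases hja : a = j
  · simpa [Matrix.updateRow_apply, hja] using contDiffAt_const
  · simpa [Matrix.updateRow_apply, hja] using hA a b

/-- The continuous multilinear map given by the determinant as a function of the rows. -/
noncomputable def detRowsCLM (n : ℕ) :
    ContinuousMultilinearMap ℝ (fun _ : Fin n => Fin n → ℝ) ℝ :=
  { (Matrix.detRowAlternating (n := Fin n) (R := ℝ)).toMultilinearMap with
    cont := Continuous.matrix_det continuous_id }

/-- Jacobi's formula `d log (det A) = tr (A⁻¹ dA)`. Since `Real.log` is even, `det A` may have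
either sign. -/
theorem hasFDerivAt_log_det {A : V → Matrix (Fin n) (Fin n) ℝ} {x : V}
    {A' : Fin n → Fin n → V →L[ℝ] ℝ}
    (hA : ∀ i j, HasFDerivAt (fun y => A y i j) (A' i j) x) (h : (A x).det ≠ 0) :
    HasFDerivAt (fun y => Real.log (A y).det) (∑ i, ∑ j, (A x)⁻¹ i j • A' j i) x := by
  have h1 := (HasFDerivAt.multilinear_comp (detRowsCLM n) (g := fun i y => A y i)
    (g' := fun i => ContinuousLinearMap.pi (A' i))
    fun i => hasFDerivAt_pi.2 fun j => hA i j).log h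
  refine h1.congr_fderiv (ContinuousLinearMap.ext fun v => ?_)
  have hrow : ∀ i, detRowsCLM n (Function.update (fun j => A x j) i fun j => A' i j v) =
      ∑ j, (A x).adjugate j i * A' i j v := by
    intro i
    -- Replacing the `i`-th row in the determinant is Cramer's rule for the transposed matrix.
    refine (Matrix.cramer_transpose_apply (A x) (fun j => A' i j v) i).symm.trans ?_
    rw [Matrix.cramer_eq_adjugate_mulVec, ← Matrix.adjugate_transpose]
    rfl
  have hval : (detRowsCLM n fun i => A x i) = (A x).det := rfl
  have hlin : ∀ i, (detRowsCLM n).toContinuousLinearMap (fun j => A x j) i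
      (ContinuousLinearMap.pi (A' i) v) =
        detRowsCLM n (Function.update (fun j => A x j) i fun j => A' i j v) := fun i => rfl
  simp only [hval, _root_.smul_apply, _root_.sum_apply, ContinuousLinearMap.comp_apply, hlin,
    hrow, smul_eq_mul, Matrix.inv_def, Ring.inverse_eq_inv', Matrix.smul_apply]
  rw [Finset.sum_comm, Finset.mul_sum]
  exact Finset.sum_congr rfl fun i _ => by
    rw [Finset.mul_sum]
    exact Finset.sum_congr rfl fun j _ => by ring

end MatrixCalculus

/-! ### The contact form on `ℝ × T^*ℝⁿ` -/

section ContactModel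

/-- The space `ℝ × T^*ℝⁿ` with the coordinates `(t, y^k, p_k)`, which carries the standard
contact form `dt + p_k dy^k`. -/
abbrev ContactSpace (n : ℕ) := ℝ × E n × (Fin n → ℝ)

/-- The coordinate differential `dy^k` on the contact space. -/
noncomputable def contactBase {n : ℕ} (k : Fin n) : ContactSpace n →L[ℝ] ℝ :=
  EuclideanSpace.proj k ∘L ContinuousLinearMap.fst ℝ (E n) (Fin n → ℝ) ∘L
    ContinuousLinearMap.snd ℝ ℝ (E n × (Fin n → ℝ))

/-- The coordinate differential `dp_k` on the contact space. -/
noncomputable def contactFibre {n : ℕ} (k : Fin n) : ContactSpace n →L[ℝ] ℝ :=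
  ContinuousLinearMap.proj (R := ℝ) (φ := fun _ : Fin n => ℝ) k ∘L
    ContinuousLinearMap.snd ℝ (E n) (Fin n → ℝ) ∘L
    ContinuousLinearMap.snd ℝ ℝ (E n × (Fin n → ℝ))

/-- The coordinate differential `dt` on the contact space. -/
noncomputable def contactTime (n : ℕ) : ContactSpace n [⋀^Fin 1]→L[ℝ] ℝ :=
  oneForm (ContinuousLinearMap.fst ℝ ℝ (E n × (Fin n → ℝ)))

/-- The standard contact form `dt + p_k dy^k`. -/
noncomputable def contactForm (n : ℕ) (q : ContactSpace n) : ContactSpace n [⋀^Fin 1]→L[ℝ] ℝ :=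
  contactTime n + oneForm (∑ k, q.2.2 k • contactBase k)

/-- The standard symplectic form `dp_k ∧ dy^k`. -/
noncomputable def symplecticForm (n : ℕ) : ContactSpace n [⋀^Fin 2]→L[ℝ] ℝ :=
  ∑ l, wedge (oneForm (contactFibre l)) (oneForm (contactBase l))

variable {n : ℕ}

theorem contDiff_contactForm : ContDiff ℝ ∞ (contactForm n) := by
  have h : contactForm n = fun q =>
      contactTime n + ∑ k, contactFibre k q • oneForm (contactBase k) := by
    funext q
    ext v
    simp [contactForm, contactFibre]
  rw [h]
  exact contDiff_const.add (ContDiff.sum fun k _ => (contactFibre k).contDiff.smul contDiff_const)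

theorem extDeriv_contactForm (q : ContactSpace n) :
    extDeriv (contactForm n) q = symplecticForm n := by
  ext v
  rw [extDeriv_apply (contDiff_contactForm.differentiable (by simp) q), Fin.sum_univ_two]
  have hd : ∀ (i : Fin 2) (u : ContactSpace n),
      fderiv ℝ (fun q => contactForm n q (i.removeNth v)) q u =
        ∑ k, contactFibre k u * contactBase k (i.removeNth v 0) := by
    intro i u
    have h : (fun q => contactForm n q (i.removeNth v)) = fun q =>
        contactTime n (i.removeNth v) +
          (∑ k, contactBase k (i.removeNth v 0) • contactFibre k) q := by
      funext q
      simp [contactForm, contactFibre, mul_comm]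
    rw [h, fderiv_const_add, ContinuousLinearMap.fderiv]
    simp [mul_comm]
  rw [hd, hd]
  have hs : symplecticForm n v = ∑ l, wedge (oneForm (contactFibre l))
      (oneForm (contactBase l)) v := by
    simp [symplecticForm]
  rw [hs]
  simp only [wedge_oneForm_apply, Finset.sum_sub_distrib]
  simp [Fin.removeNth, sub_eq_add_neg, mul_comm]

/-- `(p_k dy^k) ∧ (dp_k ∧ dy^k)^n` comes from the `2 n`-dimensional space `T^*ℝⁿ`. -/
theorem wedgeWithPow_liouville_eq_zero (a : Fin n → ℝ) :
    wedgeWithPow (oneForm (∑ k, a k • contactBase k)) (symplecticForm n) n = 0 := by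
  let ι : E n × (Fin n → ℝ) →L[ℝ] ContactSpace n := ContinuousLinearMap.inr ℝ ℝ _
  let π : ContactSpace n →L[ℝ] E n × (Fin n → ℝ) := ContinuousLinearMap.snd ℝ ℝ _
  have h1 : oneForm (∑ k, a k • contactBase (n := n) k) =
      ((oneForm (∑ k, a k • contactBase k)).compContinuousLinearMap ι).compContinuousLinearMap
        π := by
    ext v
    simp [oneForm_compContinuousLinearMap, contactBase, ι, π]
  have h2 : symplecticForm n =
      ((symplecticForm n).compContinuousLinearMap ι).compContinuousLinearMap π := by
    ext v
    simp [symplecticForm, wedge_oneForm_apply, contactBase, contactFibre, ι, π]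
  rw [h1, h2, ← wedgeWithPow_compContinuousLinearMap,
    eq_zero_of_finrank_lt (wedgeWithPow _ _ n) (by simp [two_mul])]
  rfl

theorem wedgeWithPow_contactForm (q : ContactSpace n) :
    wedgeWithPow (contactForm n q) (symplecticForm n) n =
      wedgeWithPow (contactTime n) (symplecticForm n) n := by
  rw [contactForm, wedgeWithPow_add_left, wedgeWithPow_liouville_eq_zero, add_zero]

end ContactModel

/-! ### Maps of frames to the contact space -/

section Potential

variable {n : ℕ} {G : Type*} [NormedAddCommGroup G] [NormedSpace ℝ G]

/-- The map `(y^i, g, y^i_{jk}) ↦ (f (g), y^i, y^j_{jk})` to the contact space. -/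
noncomputable def toContact (f : G → ℝ) (x : E n × G × symTen n) : ContactSpace n :=
  (f x.2.1, x.1, fun k => ∑ j, (x.2.2 : Fin n → Fin n → Fin n → ℝ) j j k)

/-- The derivative of `toContact f` when `f` has the derivative `f'`. -/
noncomputable def toContactDeriv (f' : G →L[ℝ] ℝ) : E n × G × symTen n →L[ℝ] ContactSpace n :=
  (f' ∘L ContinuousLinearMap.fst ℝ G (symTen n) ∘L
    ContinuousLinearMap.snd ℝ (E n) (G × symTen n)).prod
    ((ContinuousLinearMap.fst ℝ (E n) (G × symTen n)).prod
      (ContinuousLinearMap.pi fun k => ∑ j, dConn j j k))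

theorem dConn_apply (i j k : Fin n) (x : E n × G × symTen n) :
    dConn i j k x = (x.2.2 : Fin n → Fin n → Fin n → ℝ) i j k :=
  rfl

theorem dBase_apply (k : Fin n) (x : E n × G × symTen n) : dBase k x = x.1 k :=
  rfl

theorem toContact_eq (f : G → ℝ) :
    toContact (n := n) f = fun x => (f x.2.1, x.1,
      (ContinuousLinearMap.pi fun k => ∑ j, dConn j j k : E n × G × symTen n →L[ℝ] _) x) := by
  funext x
  refine Prod.ext rfl (Prod.ext rfl ?_)
  funext k
  simp [toContact, dConn_apply]

theorem contDiffAt_toContact {f : G → ℝ} {x : E n × G × symTen n}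
    (hf : ContDiffAt ℝ ∞ f x.2.1) : ContDiffAt ℝ ∞ (toContact f) x := by
  rw [toContact_eq]
  exact (hf.comp x (contDiff_fst.comp contDiff_snd).contDiffAt).prodMk
    (contDiff_fst.prodMk (ContinuousLinearMap.contDiff _)).contDiffAt

theorem hasFDerivAt_toContact {f : G → ℝ} {f' : G →L[ℝ] ℝ} {x : E n × G × symTen n}
    (hf : HasFDerivAt f f' x.2.1) : HasFDerivAt (toContact f) (toContactDeriv f') x := by
  rw [toContact_eq]
  exact (hf.comp x (ContinuousLinearMap.hasFDerivAt (ContinuousLinearMap.fst ℝ G (symTen n) ∘L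
    ContinuousLinearMap.snd ℝ (E n) (G × symTen n)))).prodMk
      (hasFDerivAt_fst.prodMk (ContinuousLinearMap.hasFDerivAt _))

theorem contactTime_comp_toContactDeriv (f' : G →L[ℝ] ℝ) :
    (contactTime n).compContinuousLinearMap (toContactDeriv f') =
      oneForm (f' ∘L ContinuousLinearMap.fst ℝ G (symTen n) ∘L
        ContinuousLinearMap.snd ℝ (E n) (G × symTen n)) :=
  rfl

theorem contactForm_comp_toContactDeriv (f : G → ℝ) (f' : G →L[ℝ] ℝ) (x : E n × G × symTen n) :
    (contactForm n (toContact f x)).compContinuousLinearMap (toContactDeriv f') =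
      oneForm (f' ∘L ContinuousLinearMap.fst ℝ G (symTen n) ∘L
        ContinuousLinearMap.snd ℝ (E n) (G × symTen n)) +
      oneForm (∑ k, ∑ j, (x.2.2 : Fin n → Fin n → Fin n → ℝ) j j k • dBase k) := by
  ext v
  simp [contactForm, contactTime, toContact, toContactDeriv, contactBase, dBase_apply,
    Finset.sum_mul]

theorem symplecticForm_comp_toContactDeriv (f' : G →L[ℝ] ℝ) :
    (symplecticForm n).compContinuousLinearMap (toContactDeriv f') = curvForm n G := by
  ext v
  simp [symplecticForm, curvForm, wedge_oneForm_apply, contactBase, contactFibre, toContactDeriv,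
    dBase_apply, Finset.sum_mul]

end Potential

/-! ### `Λ₁` and `Γ₁` as pullbacks of the contact form -/

section Potentials

variable {n : ℕ}

/-- The potential `-1/2 log det (y^{ij})` of `-1/2 y_{ij} dy^{ij}`. -/
noncomputable def metricPotential (n : ℕ) (g : symMat n) : ℝ :=
  -(1 / 2) * Real.log (Matrix.of (g : Fin n → Fin n → ℝ)).det

/-- The potential `-log |det (y^i_j)|` of `-v^i_k dy^k_i`; `Real.log` takes the absolute value. -/
noncomputable def framePotential (n : ℕ) (Y : Fin n → Fin n → ℝ) : ℝ :=
  -Real.log (Matrix.of Y).det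

/-- The `(i, j)` entry of a symmetric array as a functional. -/
noncomputable def symMatEntry (i j : Fin n) : symMat n →L[ℝ] ℝ :=
  ContinuousLinearMap.proj (R := ℝ) (φ := fun _ : Fin n => ℝ) j ∘L
    ContinuousLinearMap.proj (R := ℝ) (φ := fun _ : Fin n => Fin n → ℝ) i ∘L (symMat n).subtypeL

/-- The `(i, j)` entry of an array as a functional. -/
noncomputable def arrayEntry (i j : Fin n) : (Fin n → Fin n → ℝ) →L[ℝ] ℝ :=
  ContinuousLinearMap.proj (R := ℝ) (φ := fun _ : Fin n => ℝ) j ∘L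
    ContinuousLinearMap.proj (R := ℝ) (φ := fun _ : Fin n => Fin n → ℝ) i

theorem contDiffAt_metricPotential {g : symMat n}
    (hg : (Matrix.of (g : Fin n → Fin n → ℝ)).det ≠ 0) :
    ContDiffAt ℝ ∞ (metricPotential n) g :=
  contDiffAt_const.mul
    ((contDiffAt_det fun i j => (symMatEntry i j).contDiff.contDiffAt).log hg)

theorem contDiffAt_framePotential {Y : Fin n → Fin n → ℝ} (hY : (Matrix.of Y).det ≠ 0) :
    ContDiffAt ℝ ∞ (framePotential n) Y :=
  ((contDiffAt_det fun i j => (arrayEntry i j).contDiff.contDiffAt).log hY).neg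

theorem hasFDerivAt_metricPotential {g : symMat n}
    (hg : (Matrix.of (g : Fin n → Fin n → ℝ)).det ≠ 0) :
    HasFDerivAt (metricPotential n) (-(1 / 2 : ℝ) •
      ∑ i, ∑ j, (Matrix.of (g : Fin n → Fin n → ℝ))⁻¹ i j • symMatEntry j i) g :=
  (hasFDerivAt_log_det (fun i j => (symMatEntry i j).hasFDerivAt) hg).const_mul _

theorem hasFDerivAt_framePotential {Y : Fin n → Fin n → ℝ} (hY : (Matrix.of Y).det ≠ 0) :
    HasFDerivAt (framePotential n)
      (-∑ i, ∑ j, (Matrix.of Y)⁻¹ i j • arrayEntry j i) Y :=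
  (hasFDerivAt_log_det (fun i j => (arrayEntry i j).hasFDerivAt) hY).neg

theorem det_ne_zero_of_mem_redFrames {U : Set (E n)} {x : RedFrame n} (hx : x ∈ redFrames U) :
    (Matrix.of (x.2.1 : Fin n → Fin n → ℝ)).det ≠ 0 :=
  hx.2.det_pos.ne'

/-- `-1/2 y_{ij} dy^{ij}` is the differential of `metricPotential`. -/
theorem metricForm_eq {x : RedFrame n} (hx : (Matrix.of (x.2.1 : Fin n → Fin n → ℝ)).det ≠ 0) :
    metricForm n x = oneForm (fderiv ℝ (metricPotential n) x.2.1 ∘L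
      ContinuousLinearMap.fst ℝ (symMat n) (symTen n) ∘L
        ContinuousLinearMap.snd ℝ (E n) (symMat n × symTen n)) := by
  rw [(hasFDerivAt_metricPotential hx).fderiv, metricForm]
  refine congrArg oneForm (ContinuousLinearMap.ext fun v => ?_)
  have h : ∀ i j, dMetric i j v = symMatEntry j i v.2.1 := fun i j => v.2.1.2 i j
  simp [h]

theorem Lambda1_eq {x : RedFrame n} (hx : (Matrix.of (x.2.1 : Fin n → Fin n → ℝ)).det ≠ 0) :
    Lambda1 n x = pullback (toContact (metricPotential n)) (contactForm n) x := by
  have h := (contDiffAt_metricPotential hx).differentiableAt (by simp)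
  rw [pullback, (hasFDerivAt_toContact h.hasFDerivAt).fderiv, contactForm_comp_toContactDeriv,
    ← metricForm_eq hx, Lambda1]

theorem Gamma1_eq {s : Frame n} (hs : (Matrix.of s.2.1).det ≠ 0) :
    Gamma1 n s = pullback (toContact (framePotential n)) (contactForm n) s := by
  rw [pullback, (hasFDerivAt_toContact (hasFDerivAt_framePotential hs)).fderiv,
    contactForm_comp_toContactDeriv, ← oneForm_add, Gamma1]
  congr 2
  ext v <;> simp [dFrame, arrayEntry]

theorem isOpen_frames {U : Set (E n)} (hU : IsOpen U) : IsOpen (frames U) := by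
  have hc : Continuous fun s : Frame n => (Matrix.of s.2.1).det :=
    Continuous.matrix_det (continuous_fst.comp continuous_snd)
  exact (hU.preimage continuous_fst).inter (isOpen_ne.preimage hc)

theorem minSmoothness_two_le_infty : minSmoothness ℝ 2 ≤ (∞ : WithTop ℕ∞) := by
  rw [minSmoothness_of_isRCLikeNormedField]
  exact WithTop.coe_le_coe.2 (le_top : (2 : ℕ∞) ≤ ⊤)

/-- The exterior derivative of a form that is the pullback of the contact form by a map
`toContact f`. -/
theorem extDeriv_pullback_contactForm {G : Type*} [NormedAddCommGroup G] [NormedSpace ℝ G]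
    {f : G → ℝ} {x : E n × G × symTen n} (hf : ContDiffAt ℝ ∞ f x.2.1) :
    extDeriv (pullback (toContact f) (contactForm n)) x = curvForm n G := by
  have h := extDeriv_pullback (contDiff_contactForm.differentiable (by simp) (toContact f x))
    (contDiffAt_toContact hf) minSmoothness_two_le_infty
  refine h.trans ?_
  rw [extDeriv_contactForm, (hasFDerivAt_toContact
    (hf.differentiableAt (by simp)).hasFDerivAt).fderiv, symplecticForm_comp_toContactDeriv]

theorem extDeriv_Lambda1 {x : RedFrame n} (hx : x ∈ redFrames (Set.univ : Set (E n))) :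
    extDeriv (Lambda1 n) x = curvForm n (symMat n) := by
  have h : Lambda1 n =ᶠ[𝓝 x] pullback (toContact (metricPotential n)) (contactForm n) :=
    Filter.mem_of_superset ((isOpen_redFrames isOpen_univ).mem_nhds hx) fun y hy =>
      Lambda1_eq (det_ne_zero_of_mem_redFrames hy)
  rw [h.extDeriv_eq, extDeriv_pullback_contactForm
    (contDiffAt_metricPotential (det_ne_zero_of_mem_redFrames hx))]

theorem extDeriv_Gamma1 {s : Frame n} (hs : s ∈ frames (Set.univ : Set (E n))) :
    extDeriv (Gamma1 n) s = curvForm n (Fin n → Fin n → ℝ) := by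
  have h : Gamma1 n =ᶠ[𝓝 s] pullback (toContact (framePotential n)) (contactForm n) :=
    Filter.mem_of_superset ((isOpen_frames isOpen_univ).mem_nhds hs) fun y hy => Gamma1_eq hy.2
  rw [h.extDeriv_eq, extDeriv_pullback_contactForm (contDiffAt_framePotential hs.2)]

theorem pullback_pullback {V W Z : Type*} [NormedAddCommGroup V] [NormedSpace ℝ V]
    [NormedAddCommGroup W] [NormedSpace ℝ W] [NormedAddCommGroup Z] [NormedSpace ℝ Z] {k : ℕ}
    {F : V → W} {H : W → Z} (w : Z → Z [⋀^Fin k]→L[ℝ] ℝ) {x : V}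
    (hF : DifferentiableAt ℝ F x) (hH : DifferentiableAt ℝ H (F x)) :
    pullback F (pullback H w) x = pullback (H ∘ F) w x := by
  rw [pullback, pullback, pullback, fderiv_comp x hH hF]
  rfl

/-- The symmetric part of an array, as a linear retraction onto the symmetric arrays. -/
noncomputable def symMatProj (n : ℕ) : (Fin n → Fin n → ℝ) →L[ℝ] symMat n :=
  LinearMap.toContinuousLinearMap
    { toFun := fun a => ⟨fun i j => (a i j + a j i) / 2, fun i j => by simp only [add_comm]⟩
      map_add' := fun a b => by
        ext i j
        simp only [Pi.add_apply, Submodule.coe_add]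
        ring
      map_smul' := fun r a => by
        ext i j
        simp only [Pi.smul_apply, smul_eq_mul, RingHom.id_apply, Submodule.coe_smul]
        ring }

theorem symMatProj_of_mem {a : Fin n → Fin n → ℝ} (ha : a ∈ symMat n) :
    symMatProj n a = ⟨a, ha⟩ := by
  refine Subtype.ext (funext fun i => funext fun j => ?_)
  have : a i j = a j i := ha i j
  simp [symMatProj, ← this]

/-- `symmetrize` as a continuous linear map. -/
noncomputable def symmetrizeCLM (n : ℕ) : (Fin n → Fin n → Fin n → ℝ) →L[ℝ] symTen n :=
  LinearMap.toContinuousLinearMap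
    { toFun := symmetrize
      map_add' := fun a b => by
        ext i j k
        simp only [symmetrize, Pi.add_apply, Submodule.coe_add]
        ring
      map_smul' := fun r a => by
        ext i j k
        simp only [symmetrize, Pi.smul_apply, smul_eq_mul, RingHom.id_apply,
          Submodule.coe_smul]
        ring }

theorem contDiff_proj : ContDiff ℝ ∞ (proj : Frame n → RedFrame n) := by
  have h : (proj : Frame n → RedFrame n) = fun s =>
      (s.1, symMatProj n (fun i j => ∑ l, s.2.1 i l * s.2.1 j l), s.2.2) := by
    funext s
    refine Prod.ext rfl (Prod.ext ?_ rfl)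
    rw [symMatProj_of_mem]
    rfl
  rw [h]
  refine contDiff_fst.prodMk (ContDiff.prodMk ((symMatProj n).contDiff.comp ?_)
    (contDiff_snd.comp contDiff_snd))
  refine contDiff_pi.2 fun i => contDiff_pi.2 fun j => ContDiff.sum fun l _ => ?_
  have he : ∀ i l, ContDiff ℝ ∞ fun s : Frame n => s.2.1 i l := fun i l =>
    (arrayEntry i l).contDiff.comp (contDiff_fst.comp contDiff_snd)
  exact (he i l).mul (he j l)

theorem metricPotential_proj (s : Frame n) :
    metricPotential n (proj s).2.1 = framePotential n s.2.1 := by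
  have h : Matrix.of ((proj s).2.1 : Fin n → Fin n → ℝ) =
      Matrix.of s.2.1 * (Matrix.of s.2.1).transpose := by
    ext i j
    simp [proj, Matrix.mul_apply]
  rw [metricPotential, framePotential, h, Matrix.det_mul, Matrix.det_transpose, ← sq,
    Real.log_pow]
  push_cast
  ring

theorem proj_mem_redFrames {U : Set (E n)} {s : Frame n} (hs : s ∈ frames U) :
    proj s ∈ redFrames U :=
  image_proj U ▸ Set.mem_image_of_mem proj hs

/-- `p^* Λ₁ = Γ₁`, since `p` carries the one potential into the other. -/
theorem pullback_proj_Lambda1 {s : Frame n} (hs : s ∈ frames (Set.univ : Set (E n))) :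
    pullback (V := Frame n) (W := RedFrame n) proj (Lambda1 n) s = Gamma1 n s := by
  have hp := det_ne_zero_of_mem_redFrames (proj_mem_redFrames hs)
  have h1 : pullback (V := Frame n) (W := RedFrame n) proj (Lambda1 n) s =
      pullback (V := Frame n) (W := RedFrame n) proj
        (pullback (toContact (metricPotential n)) (contactForm n)) s := by
    rw [pullback, Lambda1_eq hp]
    rfl
  rw [h1, pullback_pullback _ (contDiff_proj.differentiable (by simp) s)
    ((contDiffAt_toContact (contDiffAt_metricPotential hp)).differentiableAt (by simp)),
    Gamma1_eq hs.2]
  congr 1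
  funext t
  exact Prod.ext (metricPotential_proj t) rfl

/-- A linear expression in the differential of a smooth function is smooth. -/
theorem contDiffAt_linear_fderiv {G F : Type*} [NormedAddCommGroup G] [NormedSpace ℝ G]
    [FiniteDimensional ℝ G] [NormedAddCommGroup F] [NormedSpace ℝ F] {f : G → ℝ} {g : G}
    (hf : ContDiffAt ℝ ∞ f g) (T : (G →L[ℝ] ℝ) →ₗ[ℝ] F) :
    ContDiffAt ℝ ∞ (fun g => T (fderiv ℝ f g)) g :=
  (LinearMap.toContinuousLinearMap T).contDiff.contDiffAt.comp g
    (hf.fderiv_right (by norm_cast))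

/-- A linear expression in `metricForm` is smooth. -/
theorem contDiffAt_linear_metricForm {F : Type*} [NormedAddCommGroup F] [NormedSpace ℝ F]
    {x : RedFrame n} (hx : x ∈ redFrames (Set.univ : Set (E n)))
    (T : (RedFrame n [⋀^Fin 1]→L[ℝ] ℝ) →ₗ[ℝ] F) :
    ContDiffAt ℝ ∞ (fun y => T (metricForm n y)) x := by
  let S : (symMat n →L[ℝ] ℝ) →ₗ[ℝ] (RedFrame n [⋀^Fin 1]→L[ℝ] ℝ) :=
    { toFun := fun L => oneForm (L ∘L ContinuousLinearMap.fst ℝ (symMat n) (symTen n) ∘L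
          ContinuousLinearMap.snd ℝ (E n) (symMat n × symTen n))
      map_add' := fun L L' => rfl
      map_smul' := fun r L => rfl }
  have h := contDiffAt_linear_fderiv
    (contDiffAt_metricPotential (det_ne_zero_of_mem_redFrames hx)) (T ∘ₗ S)
  refine (h.comp x (contDiff_fst.comp contDiff_snd).contDiffAt).congr_of_eventuallyEq ?_
  exact Filter.mem_of_superset ((isOpen_redFrames isOpen_univ).mem_nhds hx) fun y hy =>
    congrArg T (metricForm_eq (det_ne_zero_of_mem_redFrames hy))

/-- `metricForm` wedged with a power of a constant 2-form is smooth. -/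
theorem contDiffAt_wedgeWithPow_metricForm {x : RedFrame n}
    (hx : x ∈ redFrames (Set.univ : Set (E n))) (w : RedFrame n [⋀^Fin 2]→L[ℝ] ℝ) (m : ℕ) :
    ContDiffAt ℝ ∞ (fun y => wedgeWithPow (metricForm n y) w m) x := by
  let T : (RedFrame n [⋀^Fin 1]→L[ℝ] ℝ) →ₗ[ℝ] (RedFrame n [⋀^Fin (2 * m + 1)]→L[ℝ] ℝ) :=
    { toFun := fun α => wedgeWithPow α w m
      map_add' := fun α β => wedgeWithPow_add_left α β w m
      map_smul' := fun r α => wedgeWithPow_smul_left r α w m }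
  exact contDiffAt_linear_metricForm (F := RedFrame n [⋀^Fin (2 * m + 1)]→L[ℝ] ℝ) hx T

theorem contDiff_smul_oneForm {V : Type*} [NormedAddCommGroup V] [NormedSpace ℝ V]
    (L M : V →L[ℝ] ℝ) : ContDiff ℝ ∞ fun x => L x • oneForm M :=
  L.contDiff.smul contDiff_const

theorem contDiffAt_Lambda1 {x : RedFrame n} (hx : x ∈ redFrames (Set.univ : Set (E n))) :
    ContDiffAt ℝ ∞ (Lambda1 n) x := by
  refine ContDiffAt.add (contDiffAt_linear_metricForm (F := RedFrame n [⋀^Fin 1]→L[ℝ] ℝ) hx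
    LinearMap.id) ?_
  have h : (fun x : RedFrame n => oneForm (∑ k, ∑ j,
      (x.2.2 : Fin n → Fin n → Fin n → ℝ) j j k • dBase (n := n) (G := symMat n) k)) =
      fun x => ∑ k, ∑ j, dConn j j k x • oneForm (dBase (n := n) (G := symMat n) k) := by
    funext x
    ext v
    simp [dConn_apply]
  rw [h]
  refine (ContDiff.sum fun k _ => ContDiff.sum fun j _ => ?_).contDiffAt
  exact contDiff_smul_oneForm _ _

theorem pullback_proj_extDeriv_Lambda1 {s : Frame n}
    (hs : s ∈ frames (Set.univ : Set (E n))) :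
    pullback (V := Frame n) (W := RedFrame n) proj (extDeriv (Lambda1 n)) s =
      extDeriv (Gamma1 n) s := by
  have h := extDeriv_pullback (E := Frame n) (F := RedFrame n) (f := proj) (x := s)
    ((contDiffAt_Lambda1 (proj_mem_redFrames hs)).differentiableAt (by simp))
    contDiff_proj.contDiffAt minSmoothness_two_le_infty
  refine h.symm.trans (Filter.EventuallyEq.extDeriv_eq ?_)
  exact Filter.mem_of_superset ((isOpen_frames isOpen_univ).mem_nhds hs) fun t ht =>
    pullback_proj_Lambda1 ht

end Potentials

/-! ### The Godbillon-Vey-Losik form -/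

section GodbillonVey

variable {n : ℕ}

theorem gvlCoordForm_eq {x : RedFrame n} (hx : x ∈ redFrames (Set.univ : Set (E n))) :
    gvlCoordForm n x = pullback (toContact (metricPotential n))
      (fun _ => wedgeWithPow (contactTime n) (symplecticForm n) n) x := by
  have hd := det_ne_zero_of_mem_redFrames hx
  have h := ((contDiffAt_metricPotential hd).differentiableAt (by simp)).hasFDerivAt
  rw [pullback, (hasFDerivAt_toContact h).fderiv, wedgeWithPow_compContinuousLinearMap,
    symplecticForm_comp_toContactDeriv, contactTime_comp_toContactDeriv, ← metricForm_eq hd,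
    gvlCoordForm]

/-- The two forms agree, not only their classes: the summand `y^j_{jk} dy^k` of `Λ₁` is annihilated
by `(dΛ₁)^n`. -/
theorem gvlForm_eq_gvlCoordForm {x : RedFrame n}
    (hx : x ∈ redFrames (Set.univ : Set (E n))) : gvlForm n x = gvlCoordForm n x := by
  have hd := det_ne_zero_of_mem_redFrames hx
  have h := ((contDiffAt_metricPotential hd).differentiableAt (by simp)).hasFDerivAt
  rw [gvlCoordForm_eq hx, gvlForm, extDeriv_Lambda1 hx, Lambda1_eq hd, pullback, pullback,
    (hasFDerivAt_toContact h).fderiv,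
    ← symplecticForm_comp_toContactDeriv (n := n) (fderiv ℝ (metricPotential n) x.2.1),
    ← wedgeWithPow_compContinuousLinearMap, wedgeWithPow_contactForm]

/-- `gvlCoordForm` is closed, being the pullback of a constant form. -/
theorem extDeriv_gvlCoordForm {x : RedFrame n} (hx : x ∈ redFrames (Set.univ : Set (E n))) :
    extDeriv (gvlCoordForm n) x = 0 := by
  have h1 : gvlCoordForm n =ᶠ[𝓝 x] pullback (toContact (metricPotential n))
      (fun _ => wedgeWithPow (contactTime n) (symplecticForm n) n) :=
    Filter.mem_of_superset ((isOpen_redFrames isOpen_univ).mem_nhds hx) fun y hy =>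
      gvlCoordForm_eq hy
  rw [h1.extDeriv_eq]
  have hc : DifferentiableAt ℝ (fun _ : ContactSpace n =>
      wedgeWithPow (contactTime n) (symplecticForm n) n) (toContact (metricPotential n) x) :=
    differentiableAt_const _
  have h2 := extDeriv_pullback hc
    (contDiffAt_toContact (contDiffAt_metricPotential (det_ne_zero_of_mem_redFrames hx)))
    minSmoothness_two_le_infty
  refine h2.trans ?_
  ext v
  simp [extDeriv, ContinuousAlternatingMap.alternatizeUncurryFin_apply]

theorem contDiffAt_gvlCoordForm {x : RedFrame n} (hx : x ∈ redFrames (Set.univ : Set (E n))) :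
    ContDiffAt ℝ ∞ (gvlCoordForm n) x :=
  contDiffAt_wedgeWithPow_metricForm hx _ n

end GodbillonVey

/-! ### Transformation of reduced frames under regular maps -/

section Lift

variable {n : ℕ}

theorem contDiffAt_jac_apply {h : E n → E n} {y : E n} (hh : ContDiffAt ℝ ∞ h y) (i p : Fin n) :
    ContDiffAt ℝ ∞ (fun x => jac h x i p) y := by
  have h1 : ContDiffAt ℝ ∞ (fderiv ℝ h) y := hh.fderiv_right (by norm_cast)
  exact (EuclideanSpace.proj (𝕜 := ℝ) i).contDiff.contDiffAt.comp y
    (h1.clm_apply contDiffAt_const)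

theorem contDiffAt_hess_apply {h : E n → E n} {y : E n} (hh : ContDiffAt ℝ ∞ h y)
    (i p q : Fin n) : ContDiffAt ℝ ∞ (fun x => hess h x i p q) y :=
  ContDiffAt.clm_apply ((contDiffAt_jac_apply hh i q).fderiv_right (by norm_cast))
    contDiffAt_const

theorem contDiffAt_liftRed {h : E n → E n} {x : RedFrame n} (hh : ContDiffAt ℝ ∞ h x.1)
    (hJ : (jac h x.1).det ≠ 0) : ContDiffAt ℝ ∞ (liftRed h) x := by
  -- The submodule-valued components are images of arrays under linear projections.
  have heq : (liftRed h : RedFrame n → RedFrame n) = fun x => (h x.1,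
      symMatProj n (fun i j => ∑ k, ∑ l, jac h x.1 i k * symMatEntry k l x.2.1 * jac h x.1 j l),
      symmetrizeCLM n (fun i j k =>
        (∑ p, ∑ q, (jac h x.1)⁻¹ p j * hess h x.1 i p q * (jac h x.1)⁻¹ q k) +
          ∑ p, ∑ s, ∑ q, (jac h x.1)⁻¹ p j * jac h x.1 i s * (jac h x.1)⁻¹ q k *
            dConn s p q x)) := by
    funext x
    refine Prod.ext rfl (Prod.ext ?_ rfl)
    exact (symMatProj_of_mem (lift_symm (jac h x.1) x.2.1)).symm
  have hfst : ContDiffAt ℝ ∞ (fun x : RedFrame n => x.1) x := contDiff_fst.contDiffAt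
  have hj : ∀ i p, ContDiffAt ℝ ∞ (fun x : RedFrame n => jac h x.1 i p) x := fun i p =>
    (contDiffAt_jac_apply hh i p).comp x hfst
  have hi : ∀ i p, ContDiffAt ℝ ∞ (fun x : RedFrame n => (jac h x.1)⁻¹ i p) x :=
    contDiffAt_inv_apply hj hJ
  have hs : ∀ i p q, ContDiffAt ℝ ∞ (fun x : RedFrame n => hess h x.1 i p q) x := fun i p q =>
    (contDiffAt_hess_apply hh i p q).comp x hfst
  have hg : ∀ k l, ContDiffAt ℝ ∞ (fun x : RedFrame n => symMatEntry k l x.2.1) x := fun k l =>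
    ((symMatEntry k l).contDiff.comp (contDiff_fst.comp contDiff_snd)).contDiffAt
  have hc : ∀ i j k, ContDiffAt ℝ ∞ (fun x : RedFrame n => dConn i j k x) x := fun i j k =>
    (ContinuousLinearMap.contDiff (dConn (n := n) (G := symMat n) i j k)).contDiffAt
  rw [heq]
  refine (hh.comp x hfst).prodMk (ContDiffAt.prodMk
    ((symMatProj n).contDiff.contDiffAt.comp x ?_)
    ((symmetrizeCLM n).contDiff.contDiffAt.comp x ?_))
  · exact contDiffAt_pi.2 fun i => contDiffAt_pi.2 fun j => ContDiffAt.sum fun k _ =>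
      ContDiffAt.sum fun l _ => ((hj i k).mul (hg k l)).mul (hj j l)
  · exact contDiffAt_pi.2 fun i => contDiffAt_pi.2 fun j => contDiffAt_pi.2 fun k =>
      (ContDiffAt.sum fun p _ => ContDiffAt.sum fun q _ =>
        ((hi p j).mul (hs i p q)).mul (hi q k)).add
      (ContDiffAt.sum fun p _ => ContDiffAt.sum fun s _ => ContDiffAt.sum fun q _ =>
        (((hi p j).mul (hj i s)).mul (hi q k)).mul (hc s p q))

theorem fderiv_apply_eq_jac {h : E n → E n} {y : E n} (u : E n) (k : Fin n) :
    fderiv ℝ h y u k = ∑ m, jac h y k m * u m := by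
  have hu : u = ∑ m, u m • (e m : E n) := by
    ext m
    simp [e, Pi.single_apply]
  conv_lhs => rw [hu]
  simp [jac, mul_comm]

theorem fderiv_jac_apply {h : E n → E n} {y : E n} (u : E n) (i q : Fin n) :
    fderiv ℝ (fun x => jac h x i q) y u = ∑ p, hess h y i p q * u p := by
  have hu : u = ∑ m, u m • (e m : E n) := by
    ext m
    simp [e, Pi.single_apply]
  conv_lhs => rw [hu]
  simp [hess, mul_comm]

/-- For a smooth `h` the symmetrization in `liftConn` does nothing. -/
theorem liftConn_coe {h : E n → E n} {y : E n} (hh : ContDiffAt ℝ ∞ h y) (c : symTen n)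
    (i j k : Fin n) : (liftConn h y c : Fin n → Fin n → Fin n → ℝ) i j k =
      (∑ p, ∑ q, (jac h y)⁻¹ p j * hess h y i p q * (jac h y)⁻¹ q k) +
      ∑ p, ∑ s, ∑ q, (jac h y)⁻¹ p j * jac h y i s * (jac h y)⁻¹ q k *
        (c : Fin n → Fin n → Fin n → ℝ) s p q := by
  rw [liftConn, symmetrize_of_symm]
  intro i j k
  congr 1
  · rw [Finset.sum_comm]
    refine Finset.sum_congr rfl fun p _ => Finset.sum_congr rfl fun q _ => ?_
    rw [hess_symm hh i q p]
    ring
  · rw [Finset.sum_comm, Finset.sum_comm (γ := Fin n) (f := fun p s => ∑ q, (jac h y)⁻¹ p k *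
      jac h y i s * (jac h y)⁻¹ q j * (c : Fin n → Fin n → Fin n → ℝ) s p q)]
    refine Finset.sum_congr rfl fun s _ => ?_
    rw [Finset.sum_comm]
    refine Finset.sum_congr rfl fun p _ => Finset.sum_congr rfl fun q _ => ?_
    rw [c.2 s q p]
    ring

/-- The transformation rule of the trace `y^j_{jk}`. -/
theorem trace_liftConn {h : E n → E n} {y : E n} (hh : ContDiffAt ℝ ∞ h y)
    (hJ : (jac h y).det ≠ 0) (c : symTen n) (m : Fin n) :
    ∑ k, (∑ j, (liftConn h y c : Fin n → Fin n → Fin n → ℝ) j j k) * jac h y k m =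
      (∑ i, ∑ j, (jac h y)⁻¹ i j * hess h y j m i) +
        ∑ j, (c : Fin n → Fin n → Fin n → ℝ) j j m := by
  have hKJ : ∀ p s, ∑ j, (jac h y)⁻¹ p j * jac h y j s = if p = s then 1 else 0 := by
    intro p s
    rw [← Matrix.mul_apply, Matrix.nonsing_inv_mul _ (isUnit_iff_ne_zero.2 hJ), Matrix.one_apply]
  have h1 : ∀ k, ∑ j, (liftConn h y c : Fin n → Fin n → Fin n → ℝ) j j k =
      ∑ q, (jac h y)⁻¹ q k * ((∑ i, ∑ j, (jac h y)⁻¹ i j * hess h y j i q) +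
        ∑ j, (c : Fin n → Fin n → Fin n → ℝ) j j q) := by
    intro k
    simp only [liftConn_coe hh, Finset.sum_add_distrib, mul_add]
    congr 1
    · simp only [Finset.mul_sum]
      refine Finset.sum_comm.trans ((Finset.sum_congr rfl fun p _ => Finset.sum_comm).trans
        (Finset.sum_comm.trans ?_))
      exact Finset.sum_congr rfl fun q _ => Finset.sum_congr rfl fun p _ =>
        Finset.sum_congr rfl fun j _ => by ring
    · have h3 : ∀ p s q, ∑ j, (jac h y)⁻¹ p j * jac h y j s * (jac h y)⁻¹ q k *
          (c : Fin n → Fin n → Fin n → ℝ) s p q =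
          if p = s then (jac h y)⁻¹ q k * (c : Fin n → Fin n → Fin n → ℝ) s p q else 0 := by
        intro p s q
        simp only [mul_assoc _ ((jac h y)⁻¹ q k), ← Finset.sum_mul, hKJ, ite_mul, one_mul,
          zero_mul]
      rw [Finset.sum_comm]
      simp only [Finset.mul_sum]
      rw [Finset.sum_comm (γ := Fin n) (f := fun q j => (jac h y)⁻¹ q k * _)]
      refine Finset.sum_congr rfl fun p _ => ?_
      rw [Finset.sum_comm]
      have h4 : ∀ s, ∑ j, ∑ q, (jac h y)⁻¹ p j * jac h y j s * (jac h y)⁻¹ q k *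
          (c : Fin n → Fin n → Fin n → ℝ) s p q =
          if p = s then ∑ q, (jac h y)⁻¹ q k * (c : Fin n → Fin n → Fin n → ℝ) s p q else 0 := by
        intro s
        rw [Finset.sum_comm]
        simp only [h3]
        split_ifs <;> simp
      simp only [h4, Finset.sum_ite_eq, Finset.mem_univ, if_true]
  simp only [h1, Finset.sum_mul]
  rw [Finset.sum_comm]
  have h2 : ∀ q, ∑ k, (jac h y)⁻¹ q k * ((∑ i, ∑ j, (jac h y)⁻¹ i j * hess h y j i q) +
      ∑ j, (c : Fin n → Fin n → Fin n → ℝ) j j q) * jac h y k m =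
      (if q = m then 1 else 0) * ((∑ i, ∑ j, (jac h y)⁻¹ i j * hess h y j i q) +
        ∑ j, (c : Fin n → Fin n → Fin n → ℝ) j j q) := by
    intro q
    rw [← hKJ q m, Finset.sum_mul]
    exact Finset.sum_congr rfl fun k _ => by ring
  simp only [h2, ite_mul, one_mul, zero_mul, Finset.sum_ite_eq', Finset.mem_univ, if_true,
    hess_symm hh _ _ m]

/-- The potential `-1/2 log det (y^{ij})` changes by `-log |det J|`. -/
theorem metricPotential_liftRed {h : E n → E n} {x : RedFrame n} (hJ : (jac h x.1).det ≠ 0)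
    (hx : (Matrix.of (x.2.1 : Fin n → Fin n → ℝ)).det ≠ 0) :
    metricPotential n (liftRed h x).2.1 =
      -Real.log (jac h x.1).det + metricPotential n x.2.1 := by
  have hm : Matrix.of ((liftRed h x).2.1 : Fin n → Fin n → ℝ) =
      jac h x.1 * Matrix.of (x.2.1 : Fin n → Fin n → ℝ) * (jac h x.1).transpose := by
    ext i j
    simp only [liftRed, Matrix.of_apply, Matrix.mul_apply, Matrix.transpose_apply,
      Finset.sum_mul]
    exact Finset.sum_comm
  rw [metricPotential, metricPotential, hm, Matrix.det_mul, Matrix.det_mul,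
    Matrix.det_transpose, mul_right_comm, ← sq, Real.log_mul (pow_ne_zero 2 hJ) hx, Real.log_pow]
  push_cast
  ring

theorem posDef_liftRed {h : E n → E n} {x : RedFrame n} (hJ : (jac h x.1).det ≠ 0)
    (hx : (Matrix.of (x.2.1 : Fin n → Fin n → ℝ)).PosDef) :
    (Matrix.of ((liftRed h x).2.1 : Fin n → Fin n → ℝ)).PosDef := by
  have hm : Matrix.of ((liftRed h x).2.1 : Fin n → Fin n → ℝ) =
      jac h x.1 * Matrix.of (x.2.1 : Fin n → Fin n → ℝ) * (jac h x.1).conjTranspose := by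
    ext i j
    simp only [liftRed, Matrix.of_apply, Matrix.mul_apply,
      Matrix.conjTranspose_eq_transpose_of_trivial, Matrix.transpose_apply, Finset.sum_mul]
    exact Finset.sum_comm
  rw [hm]
  exact hx.mul_mul_conjTranspose_same (Matrix.vecMul_injective_of_isUnit
    ((Matrix.isUnit_iff_isUnit_det _).2 (isUnit_iff_ne_zero.2 hJ)))

theorem sum_trace_mul_mulVec (c : Fin n → Fin n → Fin n → ℝ) (J : Matrix (Fin n) (Fin n) ℝ)
    (u : Fin n → ℝ) : ∑ k, ∑ j, c j j k * ∑ m, J k m * u m =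
      ∑ m, (∑ k, (∑ j, c j j k) * J k m) * u m := by
  simp only [Finset.mul_sum, Finset.sum_mul, mul_assoc]
  exact (Finset.sum_congr rfl fun k _ => Finset.sum_comm).trans Finset.sum_comm

/-- `Λ₁` is invariant under the maps induced by regular maps. -/
theorem pullback_liftRed_Lambda1 {h : E n → E n} {x : RedFrame n}
    (hh : ContDiffAt ℝ ∞ h x.1) (hJ : (jac h x.1).det ≠ 0)
    (hx : x ∈ redFrames (Set.univ : Set (E n))) :
    pullback (liftRed h) (Lambda1 n) x = Lambda1 n x := by
  have hd := det_ne_zero_of_mem_redFrames hx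
  have hd' := (posDef_liftRed hJ hx.2).det_pos.ne'
  have hL : DifferentiableAt ℝ (liftRed h) x :=
    (contDiffAt_liftRed hh hJ).differentiableAt (by simp)
  have hsnd : HasFDerivAt (fun x : RedFrame n => x.2.1)
      (ContinuousLinearMap.fst ℝ (symMat n) (symTen n) ∘L
        ContinuousLinearMap.snd ℝ (E n) (symMat n × symTen n)) x :=
    ContinuousLinearMap.hasFDerivAt (ContinuousLinearMap.fst ℝ (symMat n) (symTen n) ∘L
        ContinuousLinearMap.snd ℝ (E n) (symMat n × symTen n))
  have hsnd' : HasFDerivAt (fun x : RedFrame n => x.2.1)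
      (ContinuousLinearMap.fst ℝ (symMat n) (symTen n) ∘L
        ContinuousLinearMap.snd ℝ (E n) (symMat n × symTen n)) (liftRed h x) :=
    ContinuousLinearMap.hasFDerivAt (ContinuousLinearMap.fst ℝ (symMat n) (symTen n) ∘L
        ContinuousLinearMap.snd ℝ (E n) (symMat n × symTen n))
  -- The differential of the potential after `liftRed h` is computed in two ways: by the chain rule,
  -- and from its change by `-log |det J|`.
  have hpot := ((contDiffAt_metricPotential hd).differentiableAt (by simp)).hasFDerivAt.comp x hsnd
  have hpot' := (((contDiffAt_metricPotential hd').differentiableAt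
    (by simp)).hasFDerivAt.comp (liftRed h x) hsnd').comp x hL.hasFDerivAt
  have hlog := (hasFDerivAt_log_det (A := fun x : RedFrame n => jac h x.1) (x := x)
    (fun i j => ((contDiffAt_jac hh i j).hasFDerivAt.comp x
      (hasFDerivAt_fst (p := x)))) hJ).neg
  have hev : ((metricPotential n ∘ fun x : RedFrame n => x.2.1) ∘ liftRed h) =ᶠ[𝓝 x]
      fun x => -Real.log (jac h x.1).det + metricPotential n x.2.1 := by
    have h1 : ContinuousAt (fun x : RedFrame n => (jac h x.1).det) x :=
      ContinuousAt.comp (f := fun x : RedFrame n => x.1)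
        (contDiffAt_det (fun i j => contDiffAt_jac_apply hh i j)).continuousAt
        continuous_fst.continuousAt
    filter_upwards [h1.eventually_ne hJ, (isOpen_redFrames isOpen_univ).mem_nhds hx] with y h1 h2
    exact metricPotential_liftRed h1 (det_ne_zero_of_mem_redFrames h2)
  have hkey := hpot'.unique ((hlog.add hpot).congr_of_eventuallyEq hev)
  have hbase : ∀ v, (fderiv ℝ (liftRed h) x v).1 = fderiv ℝ h x.1 v.1 := by
    intro v
    have h1 := (hasFDerivAt_fst (𝕜 := ℝ) (p := liftRed h x)).comp x hL.hasFDerivAt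
    have h2 := (hh.differentiableAt (by simp)).hasFDerivAt.comp x
      (hasFDerivAt_fst (𝕜 := ℝ) (p := x))
    exact congrArg (fun L => L v) (h1.unique h2)
  ext v
  have hkv := congrArg (fun L => L (v 0)) hkey
  simp only [pullback, Lambda1, metricForm_eq hd, metricForm_eq hd']
  simp only [ContinuousAlternatingMap.compContinuousLinearMap_apply,
    ContinuousAlternatingMap.add_apply, oneForm_apply, ContinuousLinearMap.comp_apply,
    Function.comp_apply, _root_.add_apply, _root_.neg_apply, _root_.sum_apply,
    _root_.smul_apply, ContinuousLinearMap.coe_fst', ContinuousLinearMap.coe_snd',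
    smul_eq_mul, dBase_apply, hbase] at hkv ⊢
  have hconn : ∑ k, ∑ j, ((liftRed h x).2.2 : Fin n → Fin n → Fin n → ℝ) j j k *
      (fderiv ℝ h x.1 (v 0).1) k = ∑ m, (∑ k, (∑ j,
        (liftConn h x.1 x.2.2 : Fin n → Fin n → Fin n → ℝ) j j k) * jac h x.1 k m) *
          (v 0).1 m := by
    simp only [fderiv_apply_eq_jac]
    exact sum_trace_mul_mulVec _ _ _
  have hjac : ∑ i, ∑ j, (jac h x.1)⁻¹ i j * fderiv ℝ (fun y => jac h y j i) x.1 (v 0).1 =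
      ∑ m, (∑ i, ∑ j, (jac h x.1)⁻¹ i j * hess h x.1 j m i) * (v 0).1 m := by
    simp only [fderiv_jac_apply, Finset.mul_sum, Finset.sum_mul, ← mul_assoc]
    exact (Finset.sum_congr rfl fun i _ => Finset.sum_comm).trans Finset.sum_comm
  rw [hkv, hconn, hjac]
  simp only [trace_liftConn hh hJ]
  simp only [add_mul, Finset.sum_add_distrib, ← Finset.sum_mul]
  ring

end Lift

/-! ### Canonical forms -/

section Canonical

variable {n : ℕ} {k : ℕ}

/-- A form on reduced frames is canonical if it is invariant under the maps induced by all regular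
maps of open subsets of `ℝⁿ`. -/
def IsCanonical (w : RedFrame n → RedFrame n [⋀^Fin k]→L[ℝ] ℝ) : Prop :=
  ∀ (U : Set (E n)) (h : E n → E n), IsOpen U → ContDiffOn ℝ ∞ h U →
    (∀ y ∈ U, IsUnit (jac h y)) → Set.EqOn (pullback (liftRed h) w) w (redFrames U)

theorem redFrames_mono {U U' : Set (E n)} (h : U ⊆ U') : redFrames U ⊆ redFrames U' :=
  fun _ hx => ⟨h hx.1, hx.2⟩

theorem det_jac_ne_zero {h : E n → E n} {y : E n} (hJ : IsUnit (jac h y)) : (jac h y).det ≠ 0 :=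
  ((Matrix.isUnit_iff_isUnit_det _).1 hJ).ne_zero

theorem isCanonical_Lambda1 (n : ℕ) : IsCanonical (Lambda1 n) := by
  intro U h hU hh hJ x hx
  exact pullback_liftRed_Lambda1 (hh.contDiffAt (hU.mem_nhds hx.1))
    (det_jac_ne_zero (hJ _ hx.1)) (redFrames_mono (Set.subset_univ U) hx)

theorem liftRed_mem_redFrames {h : E n → E n} {U U' : Set (E n)} {x : RedFrame n}
    (hx : x ∈ redFrames U) (hJ : IsUnit (jac h x.1)) (hU : h x.1 ∈ U') :
    liftRed h x ∈ redFrames U' :=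
  ⟨hU, posDef_liftRed (det_jac_ne_zero hJ) hx.2⟩

theorem IsCanonical.extDeriv {w : RedFrame n → RedFrame n [⋀^Fin k]→L[ℝ] ℝ}
    (hw : IsCanonical w) (hd : ∀ x ∈ redFrames (Set.univ : Set (E n)), DifferentiableAt ℝ w x) :
    IsCanonical (extDeriv (E := RedFrame n) w) := by
  intro U h hU hh hJ x hx
  have h1 := extDeriv_pullback (hd _ (liftRed_mem_redFrames hx (hJ _ hx.1) (Set.mem_univ _)))
    (contDiffAt_liftRed (hh.contDiffAt (hU.mem_nhds hx.1)) (det_jac_ne_zero (hJ _ hx.1)))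
    minSmoothness_two_le_infty
  exact h1.symm.trans (Filter.EventuallyEq.extDeriv_eq
    (Filter.mem_of_superset ((isOpen_redFrames hU).mem_nhds hx) (hw U h hU hh hJ)))

theorem isCanonical_gvlForm (n : ℕ) : IsCanonical (gvlForm n) := by
  have hd : IsCanonical (extDeriv (E := RedFrame n) (Lambda1 n)) :=
    (isCanonical_Lambda1 n).extDeriv fun x hx => (contDiffAt_Lambda1 hx).differentiableAt (by simp)
  intro U h hU hh hJ x hx
  rw [pullback, gvlForm, wedgeWithPow_compContinuousLinearMap, gvlForm]
  exact congrArg₂ (fun α w => wedgeWithPow α w n) (isCanonical_Lambda1 n U h hU hh hJ hx)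
    (hd U h hU hh hJ hx)

end Canonical

/-! ### Forms on quotients by pseudogroups -/

section Quotients

variable {n : ℕ} {M : Type*} [TopologicalSpace M] [ChartedSpace (E n) M]

theorem contDiffOn_localRep {h : OpenPartialHomeomorph M M}
    (hh : ContMDiffOn (𝓡 n) (𝓡 n) ∞ h h.source) (φ ψ : Chart n M) :
    ContDiffOn ℝ ∞ (localRep h φ ψ) (localRep h φ ψ).source := by
  rw [← contMDiffOn_iff_contDiffOn]
  have h1 := contMDiffOn_symm_of_mem_maximalAtlas φ.2
  have h2 := contMDiffOn_of_mem_maximalAtlas ψ.2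
  have hs : (localRep h φ ψ).source =
      φ.1.target ∩ φ.1.symm ⁻¹' (h.source ∩ h ⁻¹' ψ.1.source) := by
    simp [localRep]
  rw [hs]
  exact (h2.comp (hh.mono Set.inter_subset_left) fun y hy => hy.2).comp
    (h1.mono Set.inter_subset_left) fun y hy => hy.2

/-- The inverse of a coordinate expression is that of the inverse, which lies in the pseudogroup
together with the given map; hence coordinate expressions are regular. -/
theorem symm_localRep (h : OpenPartialHomeomorph M M) (φ ψ : Chart n M) :
    (localRep h φ ψ).symm = localRep h.symm ψ φ := by
  simp only [localRep, OpenPartialHomeomorph.trans_symm_eq_symm_trans_symm,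
    OpenPartialHomeomorph.symm_symm, OpenPartialHomeomorph.trans_assoc]

theorem jac_id (y : E n) : jac (fun x : E n => x) y = 1 := by
  ext i j
  simp [jac, Matrix.one_apply]

theorem jac_mul_jac_of_leftInverse {f g : E n → E n} {y : E n} (hf : DifferentiableAt ℝ f y)
    (hg : DifferentiableAt ℝ g (f y)) (h : ∀ᶠ x in 𝓝 y, g (f x) = x) :
    jac g (f y) * jac f y = 1 := by
  rw [← jac_comp hf hg, ← jac_id y]
  have he : g ∘ f =ᶠ[𝓝 y] fun x => x := h
  simp only [jac, he.fderiv_eq]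

theorem isUnit_jac_localRep {P : StructureGroupoid M}
    (hP : ∀ h ∈ P, ContMDiffOn (𝓡 n) (𝓡 n) ∞ h h.source) {h : OpenPartialHomeomorph M M}
    (hh : h ∈ P) (φ ψ : Chart n M) {y : E n} (hy : y ∈ (localRep h φ ψ).source) :
    IsUnit (jac (localRep h φ ψ) y) := by
  have h1 := (contDiffOn_localRep (hP h hh) φ ψ).contDiffAt
    ((localRep h φ ψ).open_source.mem_nhds hy)
  have h2 := (contDiffOn_localRep (hP _ (P.symm hh)) ψ φ).contDiffAt
    (x := localRep h φ ψ y) (by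
      rw [← symm_localRep]
      exact (localRep h φ ψ).open_target.mem_nhds ((localRep h φ ψ).map_source hy))
  rw [← symm_localRep] at h2
  refine (Matrix.isUnit_iff_isUnit_det _).2 (Matrix.isUnit_det_of_left_inverse
    (jac_mul_jac_of_leftInverse (h1.differentiableAt (by simp)) (h2.differentiableAt (by simp)) ?_))
  filter_upwards [(localRep h φ ψ).open_source.mem_nhds hy] with x hx
  exact (localRep h φ ψ).left_inv hx

variable {k : ℕ} {w : RedFrame n → RedFrame n [⋀^Fin k]→L[ℝ] ℝ}

theorem ofCoord_eventuallyEq (P : StructureGroupoid M) {φ : Chart n M} {x : RedFrame n}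
    (hx : x ∈ redFrames φ.1.target) : ofCoord P w φ =ᶠ[𝓝 x] w :=
  Filter.mem_of_superset ((isOpen_redFrames φ.1.open_target).mem_nhds hx) fun _ hy =>
    Set.indicator_of_mem hy w

/-- A smooth canonical form is a form on `S₂(M / P) / O(n)` for every pseudogroup `P` of local
diffeomorphisms. -/
theorem IsCanonical.ofCoord_mem_redForms (hw : IsCanonical w)
    (hs : ∀ x ∈ redFrames (Set.univ : Set (E n)), ContDiffAt ℝ ∞ w x) {P : StructureGroupoid M}
    (hP : ∀ h ∈ P, ContMDiffOn (𝓡 n) (𝓡 n) ∞ h h.source) : ofCoord P w ∈ redForms n P k := by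
  refine ⟨fun φ x hx => ?_, fun φ x hx => Set.indicator_of_notMem hx w,
    fun h hh φ ψ x hx => ?_⟩
  · exact ((hs x (redFrames_mono (Set.subset_univ _) hx)).congr_of_eventuallyEq
      (ofCoord_eventuallyEq P hx)).contDiffWithinAt
  · have hJ := fun y hy => isUnit_jac_localRep hP hh φ ψ (y := y) hy
    have hsrc : (localRep h φ ψ).source ⊆ φ.1.target := by
      intro y hy
      simp only [localRep, OpenPartialHomeomorph.trans_source] at hy
      exact hy.1
    have htgt : (localRep h φ ψ).target ⊆ ψ.1.target := by
      intro y hy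
      simp only [localRep, OpenPartialHomeomorph.trans_target] at hy
      exact hy.1.1
    have h1 : liftRed (localRep h φ ψ) x ∈ redFrames ψ.1.target :=
      liftRed_mem_redFrames hx (hJ _ hx.1) (htgt ((localRep h φ ψ).map_source hx.1))
    have h2 := hw _ _ (localRep h φ ψ).open_source (contDiffOn_localRep (hP h hh) φ ψ) hJ hx
    rw [pullback, ofCoord, Set.indicator_of_mem h1, ofCoord,
      Set.indicator_of_mem (redFrames_mono hsrc hx)]
    exact h2

theorem ofCoord_mem_closedForms {P : StructureGroupoid M} (hw : ofCoord P w ∈ redForms n P k)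
    (hd : ∀ x ∈ redFrames (Set.univ : Set (E n)), extDeriv w x = 0) :
    ofCoord P w ∈ closedForms n P k := by
  refine ⟨hw, fun φ x hx => ?_⟩
  rw [(ofCoord_eventuallyEq P hx).extDeriv_eq, hd x (redFrames_mono (Set.subset_univ _) hx)]

set_option maxSynthPendingDepth 5 in
theorem exists_represents {P : StructureGroupoid M} {w : LocalForms n P k}
    (hw : w ∈ closedForms n P k) : ∃ c : deRham n P k, Represents w c :=
  ⟨Submodule.Quotient.mk ⟨w, hw⟩, hw, rfl⟩

theorem ofCoord_gvlForm (P : StructureGroupoid M) :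
    ofCoord P (gvlForm n) = ofCoord P (gvlCoordForm n) := by
  funext φ
  exact Set.indicator_congr fun x hx =>
    gvlForm_eq_gvlCoordForm (redFrames_mono (Set.subset_univ _) hx)

theorem ofCoord_gvlCoordForm_mem_closedForms {P : StructureGroupoid M}
    (hP : ∀ h ∈ P, ContMDiffOn (𝓡 n) (𝓡 n) ∞ h h.source) :
    ofCoord P (gvlCoordForm n) ∈ closedForms n P (2 * n + 1) := by
  refine ofCoord_mem_closedForms ?_ fun x hx => extDeriv_gvlCoordForm hx
  rw [← ofCoord_gvlForm]
  refine (isCanonical_gvlForm n).ofCoord_mem_redForms (fun x hx => ?_) hP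
  refine (contDiffAt_gvlCoordForm hx).congr_of_eventuallyEq ?_
  exact Filter.mem_of_superset ((isOpen_redFrames isOpen_univ).mem_nhds hx) fun y hy =>
    gvlForm_eq_gvlCoordForm hy

end Quotients

/-! ### The trace of the canonical Gelfand-Kazhdan form -/

section GelfandKazhdan

variable {n : ℕ}

/-- Symmetry of the mixed second derivatives of a family `F_u = F (u, ·)`. -/
theorem hasDerivAt_fderiv_comm {V W : Type*} [NormedAddCommGroup V] [NormedSpace ℝ V]
    [NormedAddCommGroup W] [NormedSpace ℝ W] {F : ℝ × V → W} {u : ℝ} {t : V}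
    (hF : ContDiffAt ℝ ∞ F (u, t)) (v : V) :
    HasDerivAt (fun r => fderiv ℝ (fun x => F (r, x)) t v)
      (fderiv ℝ (fun x => deriv (fun r => F (r, x)) u) t v) u := by
  have h1 : ContDiffAt ℝ ∞ (fderiv ℝ F) (u, t) := hF.fderiv_right (by norm_cast)
  have h2 : HasFDerivAt (fderiv ℝ F) (fderiv ℝ (fderiv ℝ F) (u, t)) (u, t) :=
    (h1.differentiableAt (by simp)).hasFDerivAt
  have hev : ∀ᶠ q in 𝓝 (u, t), DifferentiableAt ℝ F q :=
    ((hF.of_le (m := 1) (by norm_cast)).eventually (by norm_cast)).mono fun q hq =>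
      hq.differentiableAt one_ne_zero
  have hu : HasDerivAt (fun r : ℝ => (r, t)) ((1, 0) : ℝ × V) u :=
    (hasDerivAt_id u).prodMk (hasDerivAt_const u t)
  have hx : HasFDerivAt (fun x : V => (u, x)) (ContinuousLinearMap.inr ℝ ℝ V) t :=
    hasFDerivAt_prodMk_right u t
  -- Partial derivatives are values of the total derivative.
  have e1 : (fun r => fderiv ℝ (fun x => F (r, x)) t v) =ᶠ[𝓝 u]
      fun r => fderiv ℝ F (r, t) (0, v) := by
    filter_upwards [hu.continuousAt.eventually hev] with r hr
    have := (hr.hasFDerivAt.comp t (hasFDerivAt_prodMk_right r t)).fderiv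
    exact congrArg (fun L => L v) this
  have e2 : (fun x => deriv (fun r => F (r, x)) u) =ᶠ[𝓝 t]
      fun x => fderiv ℝ F (u, x) (1, 0) := by
    filter_upwards [hx.continuousAt.eventually hev] with x hxd
    exact (hxd.hasFDerivAt.comp_hasDerivAt u
      ((hasDerivAt_id u).prodMk (hasDerivAt_const u x))).deriv
  have h3 : fderiv ℝ (fun x => deriv (fun r => F (r, x)) u) t v =
      fderiv ℝ (fderiv ℝ F) (u, t) (1, 0) (0, v) := by
    have h5 : HasFDerivAt (fun x => fderiv ℝ F (u, x) (1, 0)) _ t :=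
      (h2.comp t hx).clm_apply (hasFDerivAt_const ((1, 0) : ℝ × V) t)
    rw [e2.fderiv_eq, h5.fderiv, (hF.isSymmSndFDerivAt minSmoothness_two_le_infty).eq]
    simp
  rw [h3]
  refine HasDerivAt.congr_of_eventuallyEq ?_ e1
  have h4 : HasDerivAt (fun r => fderiv ℝ F (r, t)) (fderiv ℝ (fderiv ℝ F) (u, t) (1, 0)) u :=
    h2.comp_hasDerivAt u hu
  exact (ContinuousLinearMap.apply ℝ W ((0, v) : ℝ × V)).hasFDerivAt.comp_hasDerivAt u h4

/-- For a smooth family `F_u = F (u, ·)`, the derivative in `u` of the Jacobian matrix of `F_u` is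
the Jacobian matrix of the derivative of `F_u` in `u`. -/
theorem hasDerivAt_jac_comm {F : ℝ × E n → E n} {u : ℝ} {t : E n}
    (hF : ContDiffAt ℝ ∞ F (u, t)) (i j : Fin n) :
    HasDerivAt (fun r => jac (fun x => F (r, x)) t i j)
      (jac (fun x => deriv (fun r => F (r, x)) u) t i j) u :=
  (EuclideanSpace.proj (𝕜 := ℝ) i).hasFDerivAt.comp_hasDerivAt u (hasDerivAt_fderiv_comm hF (e j))

/-- The value of `Γ₁` in coordinates. -/
theorem Gamma1_apply (s τ : Frame n) : Gamma1 n s (fun _ => τ) =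
    -(∑ i, ∑ k, (Matrix.of s.2.1)⁻¹ i k * τ.2.1 k i) +
      ∑ k, (∑ i, (s.2.2 : Fin n → Fin n → Fin n → ℝ) i i k) * τ.1 k := by
  simp [Gamma1, dFrame, dBase_apply, Finset.sum_mul]

/-- The trace `y^i_{ik}` of the second order part of the frame of a map with a smooth left inverse
`φ`, in terms of the second derivatives of `φ`. -/
theorem trace_frameCoord {f φ : E n → E n} (hf : ContDiffAt ℝ ∞ f 0)
    (hφ : ContDiffAt ℝ ∞ φ (f 0)) (h : ∀ᶠ t in 𝓝 (0 : E n), φ (f t) = t) (k : Fin n) :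
    ∑ i, ((frameCoord f).2.2 : Fin n → Fin n → Fin n → ℝ) i i k =
      -∑ i, ∑ a, hess φ (f 0) i k a * jac f 0 a i := by
  have hVJ : jac φ (f 0) * jac f 0 = 1 := jac_mul_jac_of_leftInverse
    (hf.differentiableAt (by simp)) (hφ.differentiableAt (by simp)) h
  have hV : (jac f 0)⁻¹ = jac φ (f 0) := Matrix.inv_eq_left_inv hVJ
  have hFV : ∀ b k, ∑ q, jac f 0 b q * jac φ (f 0) q k = if b = k then 1 else 0 := by
    intro b k
    rw [← Matrix.mul_apply, mul_eq_one_comm.1 hVJ, Matrix.one_apply]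
  -- The second derivatives of `φ ∘ f = id` vanish.
  have hzero : ∀ i p q, hess (φ ∘ f) 0 i p q = 0 := by
    intro i p q
    have h1 : (fun x => jac (φ ∘ f) x i q) =ᶠ[𝓝 0]
        fun _ => (1 : Matrix (Fin n) (Fin n) ℝ) i q := by
      filter_upwards [h.eventually_nhds] with x hx
      have he : φ ∘ f =ᶠ[𝓝 x] fun t => t := hx
      rw [← jac_id x]
      simp only [jac, he.fderiv_eq]
    rw [hess, h1.fderiv_eq]
    simp
  have hsec : ∀ p q, ∑ i, jac φ (f 0) p i * hess f 0 i p q =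
      -∑ b, (∑ a, hess φ (f 0) p b a * jac f 0 a p) * jac f 0 b q := by
    intro p q
    have h1 := hzero p p q
    rw [hess_comp hf hφ] at h1
    rw [eq_neg_of_add_eq_zero_right h1, Finset.sum_comm]
    simp only [Finset.sum_mul, hess_symm hφ p]
  have hsymm : ∀ i j k, ∑ p, ∑ q, jac φ (f 0) p j * hess f 0 i p q * jac φ (f 0) q k =
      ∑ p, ∑ q, jac φ (f 0) p k * hess f 0 i p q * jac φ (f 0) q j := by
    intro i j k
    rw [Finset.sum_comm]
    refine Finset.sum_congr rfl fun p _ => Finset.sum_congr rfl fun q _ => ?_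
    rw [hess_symm hf i q p]
    ring
  rw [frameCoord, hV, symmetrize_of_symm hsymm]
  calc ∑ i, ∑ p, ∑ q, jac φ (f 0) p i * hess f 0 i p q * jac φ (f 0) q k
      = ∑ p, ∑ q, (∑ i, jac φ (f 0) p i * hess f 0 i p q) * jac φ (f 0) q k := by
        simp only [Finset.sum_mul]
        exact Finset.sum_comm.trans (Finset.sum_congr rfl fun p _ => Finset.sum_comm)
    _ = -∑ p, ∑ b, (∑ a, hess φ (f 0) p b a * jac f 0 a p) *
          ∑ q, jac f 0 b q * jac φ (f 0) q k := by
        have hA : ∀ A : Fin n → ℝ, ∑ q, (∑ b, A b * jac f 0 b q) * jac φ (f 0) q k =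
            ∑ b, A b * ∑ q, jac f 0 b q * jac φ (f 0) q k := by
          intro A
          simp only [Finset.sum_mul, Finset.mul_sum, mul_assoc]
          exact Finset.sum_comm
        simp only [hsec, neg_mul, Finset.sum_neg_distrib, hA]
    _ = _ := by simp [hFV]

theorem Gamma1_eq_trace_gkTheta (k : ℝ × E n → E n) (φ : E n → E n) (s τ : Frame n)
    (hk : ContDiffAt ℝ ∞ k (0, 0)) (hφ : ContDiffAt ℝ ∞ φ (k (0, 0)))
    (hinv : ∀ᶠ t in 𝓝 (0 : E n), φ (k (0, t)) = t)
    (hs : frameCoord (fun t => k (0, t)) = s)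
    (hτ : HasDerivAt (fun u : ℝ => frameCoord fun t => k (u, t)) τ 0) :
    Gamma1 n s (fun _ => τ) = ∑ i, gkTheta k φ i i := by
  subst hs
  have hpt : ContDiffAt ℝ ∞ (fun t : E n => ((0 : ℝ), t)) 0 :=
    contDiffAt_const.prodMk contDiffAt_id
  have hpu : ContDiffAt ℝ ∞ (fun u : ℝ => (u, (0 : E n))) 0 :=
    contDiffAt_id.prodMk contDiffAt_const
  have hk0 : ContDiffAt ℝ ∞ (fun t => k (0, t)) 0 := hk.comp (0 : E n) hpt
  have hVJ : jac φ (k (0, 0)) * jac (fun t => k (0, t)) 0 = 1 :=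
    jac_mul_jac_of_leftInverse (hk0.differentiableAt (by simp))
      (hφ.differentiableAt (by simp)) hinv
  have hV : (jac (fun t => k (0, t)) 0)⁻¹ = jac φ (k (0, 0)) := Matrix.inv_eq_left_inv hVJ
  -- The components of the tangent vector.
  have hτ1 : HasDerivAt (fun u : ℝ => k (u, 0)) τ.1 0 :=
    (ContinuousLinearMap.fst ℝ (E n) ((Fin n → Fin n → ℝ) × symTen n)).hasFDerivAt.comp_hasDerivAt
      (0 : ℝ) hτ
  have hτ2 : ∀ i j, HasDerivAt (fun u : ℝ => jac (fun t => k (u, t)) 0 i j) (τ.2.1 i j) 0 :=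
    fun i j => (dFrame i j).hasFDerivAt.comp_hasDerivAt (0 : ℝ) hτ
  have hF : ContDiffAt ℝ ∞ (fun q => φ (k q)) ((0 : ℝ), (0 : E n)) := hφ.comp _ hk
  -- The chain rule for the Jacobian matrix of `φ ∘ k_u`.
  have hevk : ∀ᶠ u in 𝓝 (0 : ℝ), DifferentiableAt ℝ (fun t => k (u, t)) 0 := by
    have h1 := (hk.of_le (m := 1) (by norm_cast)).eventually (by norm_cast)
    filter_upwards [hpu.continuousAt.eventually h1] with u hu
    exact (hu.differentiableAt one_ne_zero).comp (0 : E n)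
      ((differentiableAt_const u).prodMk differentiableAt_id)
  have hevφ : ∀ᶠ u in 𝓝 (0 : ℝ), DifferentiableAt ℝ φ (k (u, 0)) := by
    have h1 := (hφ.of_le (m := 1) (by norm_cast)).eventually (by norm_cast)
    filter_upwards [hτ1.continuousAt.eventually h1] with u hu
    exact hu.differentiableAt one_ne_zero
  have hprod : ∀ i, HasDerivAt (fun u => jac (fun t => φ (k (u, t))) 0 i i)
      (∑ a, ((∑ p, hess φ (k (0, 0)) i p a * τ.1 p) * jac (fun t => k (0, t)) 0 a i +
        jac φ (k (0, 0)) i a * τ.2.1 a i)) 0 := by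
    intro i
    have h1 : (fun u => jac (fun t => φ (k (u, t))) 0 i i) =ᶠ[𝓝 0]
        fun u => ∑ a, jac φ (k (u, 0)) i a * jac (fun t => k (u, t)) 0 a i := by
      filter_upwards [hevk, hevφ] with u h1 h2
      rw [← Matrix.mul_apply, ← jac_comp h1 h2]
      rfl
    refine HasDerivAt.congr_of_eventuallyEq (HasDerivAt.fun_sum fun a _ => ?_) h1
    have h2 := (contDiffAt_jac hφ i a).hasFDerivAt.comp_hasDerivAt (0 : ℝ) hτ1
    rw [fderiv_jac_apply] at h2
    exact h2.mul (hτ2 a i)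
  have hθ : ∀ i, gkTheta k φ i i = -∑ a, ((∑ p, hess φ (k (0, 0)) i p a * τ.1 p) *
      jac (fun t => k (0, t)) 0 a i + jac φ (k (0, 0)) i a * τ.2.1 a i) := by
    intro i
    rw [← (hasDerivAt_jac_comm hF i i).unique (hprod i)]
    have h1 : gkField k φ = -fun t => deriv (fun u : ℝ => φ (k (u, t))) 0 := rfl
    simp [gkTheta, jac, h1, fderiv_neg]
  have hV' : (Matrix.of (frameCoord fun t => k (0, t)).2.1)⁻¹ = jac φ (k (0, 0)) := hV
  rw [Gamma1_apply, hV']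
  simp only [trace_frameCoord hk0 hφ hinv, hθ]
  simp only [Finset.sum_neg_distrib, neg_mul, Finset.sum_add_distrib, neg_add_rev, Finset.sum_mul]
  congr 2
  refine Finset.sum_comm.trans (Finset.sum_congr rfl fun i _ => Finset.sum_comm.trans ?_)
  exact Finset.sum_congr rfl fun a _ => Finset.sum_congr rfl fun p _ => by ring

end GelfandKazhdan

end Losik

theorem mainTheorem7 (n : ℕ) :
    -- `Λ₁` is canonical: it is invariant under the maps `S₂(U) / O(n) → S₂(V) / O(n)` induced by
    -- regular maps `h : U → V` of open subsets of `ℝⁿ`.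
    (∀ (U : Set (E n)) (h : E n → E n), IsOpen U → ContDiffOn ℝ ∞ h U →
      (∀ y ∈ U, IsUnit (jac h y)) →
      Set.EqOn (pullback (liftRed h) (Lambda1 n)) (Lambda1 n) (redFrames U)) ∧
    -- `p^* Λ₁ = Γ₁` on `S₂(U)`,
    Set.EqOn (pullback (V := Frame n) (W := RedFrame n) proj (Lambda1 n)) (Gamma1 n) (frames (Set.univ : Set (E n))) ∧
    -- where `Γ₁ = θ^i_i` is the trace of the canonical Gelfand-Kazhdan form: on the tangent vector
    -- `τ` at the frame `s` represented by a smooth family `k_u` of regular maps, with local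
    -- inverse `φ` of `k_0`.
    (∀ (k : ℝ × E n → E n) (φ : E n → E n) (s τ : Frame n),
      ContDiffAt ℝ ∞ k (0, 0) → ContDiffAt ℝ ∞ φ (k (0, 0)) →
      (∀ᶠ t in 𝓝 (0 : E n), φ (k (0, t)) = t) →
      frameCoord (fun t => k (0, t)) = s →
      HasDerivAt (fun u : ℝ => frameCoord fun t => k (u, t)) τ 0 →
      Gamma1 n s (fun _ => τ) = ∑ i, gkTheta k φ i i) ∧
    -- `dΛ₁ = dΓ₁`: both are `dy^k_{kl} ∧ dy^l` in coordinates, and `p^* dΛ₁ = dΓ₁`.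
    Set.EqOn (extDeriv (Lambda1 n)) (fun _ => curvForm n (symMat n))
      (redFrames (Set.univ : Set (E n))) ∧
    Set.EqOn (extDeriv (Gamma1 n)) (fun _ => curvForm n (Fin n → Fin n → ℝ))
      (frames (Set.univ : Set (E n))) ∧
    Set.EqOn (pullback (V := Frame n) (W := RedFrame n) proj (extDeriv (Lambda1 n))) (extDeriv (Gamma1 n))
      (frames (Set.univ : Set (E n))) ∧
    -- For every quotient `X = M / P` of a smooth `n`-manifold by a pseudogroup of local
    -- diffeomorphisms, `Λ₁` is a 1-form on `S₂(X) / O(n)`, and the class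
    -- `[Λ₁ ∧ (dΛ₁)^n]` is represented by `-1/2 y_{ij} dy^{ij} ∧ (dy^k_{kl} ∧ dy^l)^n`.
    ∀ (M : Type*) [TopologicalSpace M] [ChartedSpace (E n) M] [IsManifold (𝓡 n) ∞ M]
      (P : StructureGroupoid M),
      (∀ h ∈ P, ContMDiffOn (𝓡 n) (𝓡 n) ∞ h h.source) →
      ofCoord P (Lambda1 n) ∈ redForms n P 1 ∧
      ∃ c : deRham n P (2 * n + 1),
        Represents (ofCoord P (gvlForm n)) c ∧ Represents (ofCoord P (gvlCoordForm n)) c := by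
  refine ⟨isCanonical_Lambda1 n, fun s hs => pullback_proj_Lambda1 hs,
    Gamma1_eq_trace_gkTheta, fun x hx => extDeriv_Lambda1 hx, fun s hs => extDeriv_Gamma1 hs,
    fun s hs => pullback_proj_extDeriv_Lambda1 hs, fun M _ _ _ P hP => ⟨?_, ?_⟩⟩
  · exact (isCanonical_Lambda1 n).ofCoord_mem_redForms (fun x hx => contDiffAt_Lambda1 hx) hP
  · obtain ⟨c, hc⟩ := exists_represents (ofCoord_gvlCoordForm_mem_closedForms hP)
    exact ⟨c, (ofCoord_gvlForm (n := n) P).symm ▸ hc, hc⟩
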